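/- **Theorem 1 (Local existence and uniqueness).** Let $\alpha\in(0,1)$, $\gamma=1-\alpha$ and $0<q<\gamma$. For $s\in\mathbb R$ and $f:\mathbb R\to\mathbb R$ put $\|f\|_s=\sup_{x\ge 0}|f(x)|(1+x)^{-s}$. For odd $f$ let $$u[f](x)=-\int_0^\infty\Big(\frac1{|y-x|^{\gamma}}-\frac1{|x+y|^{\gamma}}\Big)f(y)\,dy ,$$ which is the velocity $-\int_{\mathbb R}|y-x|^{-\gamma}f(y)\,dy$ of the $\alpha$-patch model, understood by pairing $y$ with $-y$. Let $\omega_0\in C^2(\mathbb R)$ be odd with $$\|\omega_0\|_q+\|\omega_0'\|_{q-1}+\|\omega_0''\|_{q-2}<\infty .$$ Then there is a $T>0$ for which there exists exactly one function $\omega:[0,T]\times\mathbb R\to\mathbb R$ such that - $\omega\in C^1([0,T]\times\mathbb R)$, with one-sided time derivatives at $t=0$ and $t=T$; - $\omega(t,\cdot)$ is odd and $\|\omega(t,\cdot)\|_q+\|\omega_x(t,\cdot)\|_{q-1}<\infty$ for every $t\in[0,T]$; - $\omega_t+u[\omega]\,\omega_x=0$ on $[0,T]\times\mathbb R$, where $u[\omega](t,x)=u[\omega(t,\cdot)](x)$;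 - $\omega(0,\cdot)=\omega_0$. -/

import Mathlib

open Set MeasureTheory
open scoped ENNReal

noncomputable section

namespace AlphaPatch

/-- The weighted sup norm `‖f‖_s = sup_{x ≥ 0} |f x| (1 + x)^{-s}`, with values in `[0, ∞]`. -/
def weightedNorm (s : ℝ) (f : ℝ → ℝ) : ℝ≥0∞ :=
  ⨆ (x : ℝ) (_ : 0 ≤ x), ENNReal.ofReal (|f x| * (1 + x) ^ (-s))

/-- The kernel `K(x, y) = |y - x|^{-γ} - |x + y|^{-γ}`. -/
def kernel (γ x y : ℝ) : ℝ :=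
  1 / |y - x| ^ γ - 1 / |x + y| ^ γ

/-- The velocity field `u[f](x) = -∫_ℝ |y - x|^{-γ} f(y) dy` of an odd function `f`. The integral
over the line need not converge absolutely when `f` grows at infinity; it is understood by pairing
`y` with `-y`, i.e. as `-∫_0^∞ K(x, y) f(y) dy`, which converges absolutely for every continuous
`f` with `‖f‖_q < ∞` for some `q < γ`. -/
def velocity (γ : ℝ) (f : ℝ → ℝ) (x : ℝ) : ℝ :=
  -∫ y in Ioi (0 : ℝ), kernel γ x y * f y

/-- `ω` is an odd classical solution on `[0, T] × ℝ` of `ω_t + u[ω] ω_x = 0`, `ω(0, ·) = ω₀`, in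
the class `‖ω(t, ·)‖_q + ‖ω_x(t, ·)‖_{q-1} < ∞` for all `t ∈ [0, T]`. Only the values of `ω` on
`[0, T] × ℝ` matter; time derivatives at `t = 0` and `t = T` are one-sided. -/
structure IsSolution (γ q T : ℝ) (ω₀ : ℝ → ℝ) (ω : ℝ → ℝ → ℝ) : Prop where
  contDiffOn : ContDiffOn ℝ 1 (fun p : ℝ × ℝ => ω p.1 p.2) (Icc 0 T ×ˢ univ)
  odd : ∀ t ∈ Icc 0 T, ∀ x, ω t (-x) = -ω t x
  growth : ∀ t ∈ Icc 0 T,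
    weightedNorm q (ω t) + weightedNorm (q - 1) (deriv (ω t)) < ∞
  initial : ∀ x, ω 0 x = ω₀ x
  equation : ∀ t ∈ Icc 0 T, ∀ x,
    derivWithin (fun s => ω s x) (Icc 0 T) t + velocity γ (ω t) x * deriv (ω t) x = 0

end AlphaPatch

end

/-!
Solutions are constructed in Lagrangian coordinates and compared in Eulerian coordinates.

Existence. Look for `ω(t, X(t, a)) = ω₀(a)` with `X(t, a) = a + ∫_0^a v(t, |s|) ds`, where `v` is
bounded and small. Differentiating `X_t = u[ω](X)` in the label `a`, and changing variables in the
integral for `u[ω]_x`, gives the ordinary differential equation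
`v_t(a) = -(1 + v(a)) ∫ |X(a) - X(y)|^{-γ} ω₀'(y) dy`
in the space of bounded continuous functions. Its right-hand side is Lipschitz in `v` because `X`
is bi-Lipschitz and `ω₀'` decays like `(1 + |y|)^{q - 1}` with `q < γ`.

Uniqueness. The velocity of `f` is at most `C ‖f‖_p (1 + x)^{1 - γ + p}`, so the difference of two
solutions solves a transport equation with sublinear velocity whose source is of lower order
against the bound on `ω_x`, and a maximum principle in the weight `(1 + x)^p`, `q < p < γ`, makes
it vanish. This needs `‖ω(t, ·)‖_q` bounded uniformly in `t`, while only its finiteness is assumed: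
by Baire's theorem it is bounded on some time interval around any point of a closed bad set, and
the transport equation, run forwards or backwards, carries the bound across the gaps.
-/

noncomputable section

namespace AlphaPatch

open Filter Topology
open scoped BoundedContinuousFunction

/-! ### A weighted maximum principle for transport equations on a half-line -/

/-- The pointwise bound `|f x| ≤ N (L + x)^s` on the half-line. For `L = 1` the least such `N` is
`‖f‖_s`; the shift `L` gives equivalent norms in which terms of lower order become small. -/
def WeightedBound (L s N : ℝ) (f : ℝ → ℝ) : Prop :=
  ∀ ⦃x⦄, 0 ≤ x → |f x| ≤ N * (L + x) ^ s

/-- `φ` is a solution, vanishing at `x = 0`, of the transport equation `φ_t + b φ_x = f` on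
`[a, c] × (0, ∞)`, with one-sided time derivatives at `t = a` and `t = c`. -/
structure IsTransport (a c : ℝ) (b f φ : ℝ → ℝ → ℝ) : Prop where
  continuousOn : ContinuousOn (fun z : ℝ × ℝ => φ z.1 z.2) (Icc a c ×ˢ Ici 0)
  boundary : ∀ t ∈ Icc a c, φ t 0 = 0
  equation : ∀ t ∈ Icc a c, ∀ x, 0 < x → ∃ φt φx, HasDerivWithinAt (fun s => φ s x) φt (Icc a c) t ∧
    HasDerivAt (φ t) φx x ∧ φt + b t x * φx = f t x

/-- The factor `e^{-l (t - a)} (L + x)^{-p}`, which turns a bound in the weight `(L + x)^p` growing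
like `e^{l (t - a)}` in time into a plain sup bound. -/
def dampingFactor (a l L p t x : ℝ) : ℝ :=
  Real.exp (-(l * (t - a))) * (L + x) ^ (-p)

section maximumPrinciple

variable {a c t L q p l N N₀ B R : ℝ} {b f φ : ℝ → ℝ → ℝ}

theorem WeightedBound.nonneg {g : ℝ → ℝ} (hL : 0 < L) (hg : WeightedBound L p N g) : 0 ≤ N := by
  have h := (abs_nonneg _).trans (hg le_rfl)
  exact nonneg_of_mul_nonneg_left h (by positivity)

theorem WeightedBound.mono {g : ℝ → ℝ} (hL : 1 ≤ L) (hqp : q ≤ p) (hg : WeightedBound L q N g) :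
    WeightedBound L p N g := fun x hx => by
  have hN := hg.nonneg (one_pos.trans_le hL)
  exact (hg hx).trans (by gcongr; linarith)

theorem IsTransport.mono (h : IsTransport a c b f φ) {a' c' : ℝ} (hsub : Icc a' c' ⊆ Icc a c) :
    IsTransport a' c' b f φ where
  continuousOn := h.continuousOn.mono (prod_mono_left hsub)
  boundary t ht := h.boundary t (hsub ht)
  equation t ht x hx := by
    obtain ⟨φt, φx, h1, h2, h3⟩ := h.equation t (hsub ht) x hx
    exact ⟨φt, φx, h1.mono hsub, h2, h3⟩

theorem IsTransport.reverse (h : IsTransport a c b f φ) :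
    IsTransport a c (fun t x => -b (a + c - t) x) (fun t x => -f (a + c - t) x)
      (fun t => φ (a + c - t)) := by
  have hrev : MapsTo (fun t => a + c - t) (Icc a c) (Icc a c) := fun t ht =>
    ⟨by linarith [ht.2], by linarith [ht.1]⟩
  refine ⟨?_, fun t ht => h.boundary _ (hrev ht), fun t ht x hx => ?_⟩
  · exact h.continuousOn.comp (f := fun z : ℝ × ℝ => (a + c - z.1, z.2)) (by fun_prop)
      fun z hz => ⟨hrev hz.1, hz.2⟩
  · obtain ⟨φt, φx, h1, h2, h3⟩ := h.equation _ (hrev ht) x hx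
    refine ⟨φt * -1, φx, ?_, h2, by linear_combination -h3⟩
    exact h1.comp t ((hasDerivAt_id t).const_sub (a + c)).hasDerivWithinAt hrev

theorem hasDerivWithinAt_nonneg_of_forall_le {g : ℝ → ℝ} {g' : ℝ}
    (hg : HasDerivWithinAt g g' (Icc a c) t) (hat : a < t) (htc : t ≤ c)
    (hmax : ∀ s ∈ Icc a c, g s ≤ g t) : 0 ≤ g' := by
  have htangent : a - t ∈ posTangentConeAt (Icc a c) t := sub_mem_posTangentConeAt_of_segment_subset
    ((convex_Icc a c).segment_subset ⟨hat.le, htc⟩ ⟨le_rfl, hat.le.trans htc⟩)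
  have hmax' : IsLocalMaxOn g (Icc a c) t := eventually_nhdsWithin_of_forall hmax
  have h := hmax'.hasFDerivWithinAt_nonpos hg.hasFDerivWithinAt htangent
  simp only [ContinuousLinearMap.toSpanSingleton_apply, smul_eq_mul] at h
  exact nonneg_of_mul_nonpos_right h (sub_neg.2 hat)

theorem exists_abs_isMaxOn_of_decay {ψ : ℝ → ℝ → ℝ}
    (hcont : ContinuousOn (fun z : ℝ × ℝ => ψ z.1 z.2) (Icc a c ×ˢ Ici 0))
    (hdecay : ∀ ε > 0, ∀ᶠ x in atTop, ∀ t ∈ Icc a c, |ψ t x| < ε)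
    {t₁ x₁ : ℝ} (ht₁ : t₁ ∈ Icc a c) (hx₁ : 0 ≤ x₁) (hne : ψ t₁ x₁ ≠ 0) :
    ∃ t₀ ∈ Icc a c, ∃ x₀, 0 ≤ x₀ ∧ ∀ t ∈ Icc a c, ∀ x, 0 ≤ x → |ψ t x| ≤ |ψ t₀ x₀| := by
  obtain ⟨X, hX⟩ := eventually_atTop.1 (hdecay _ (abs_pos.2 hne))
  have houtside : ∀ᶠ z in cocompact (ℝ × ℝ) ⊓ 𝓟 (Icc a c ×ˢ Ici 0), |ψ z.1 z.2| ≤ |ψ t₁ x₁| := by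
    rw [eventually_inf_principal]
    have hK : IsCompact (Icc a c ×ˢ Icc 0 X) := isCompact_Icc.prod isCompact_Icc
    filter_upwards [hK.compl_mem_cocompact] with z hz hzS
    exact (hX z.2 (not_lt.1 fun h => hz ⟨hzS.1, hzS.2, h.le⟩) z.1 hzS.1).le
  obtain ⟨⟨t₀, x₀⟩, ⟨ht₀, hx₀⟩, hmax⟩ := hcont.abs.exists_isMaxOn' (isClosed_Icc.prod isClosed_Ici)
    (show (t₁, x₁) ∈ Icc a c ×ˢ Ici 0 from ⟨ht₁, hx₁⟩) houtside
  exact ⟨t₀, ht₀, x₀, hx₀, fun t ht x hx => hmax (show (t, x) ∈ Icc a c ×ˢ Ici 0 from ⟨ht, hx⟩)⟩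

/-- At a positive maximum of `|φ|` after the initial time, `φ φ_x = 0` and `φ φ_t ≥ 0`. -/
theorem IsTransport.abs_le_of_source_inward (h : IsTransport a c b f φ)
    (hdecay : ∀ ε > 0, ∀ᶠ x in atTop, ∀ t ∈ Icc a c, |φ t x| < ε)
    (hf : ∀ t ∈ Icc a c, ∀ x, 0 < x → φ t x ≠ 0 → (∀ y, 0 ≤ y → |φ t y| ≤ |φ t x|) →
      f t x * φ t x < 0)
    (hN : ∀ x, 0 ≤ x → |φ a x| ≤ N) :
    ∀ t ∈ Icc a c, ∀ x, 0 ≤ x → |φ t x| ≤ N := by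
  by_contra! hcon
  obtain ⟨t₁, ht₁, x₁, hx₁, hlt⟩ := hcon
  have hN0 : 0 ≤ N := (abs_nonneg _).trans (hN 0 le_rfl)
  obtain ⟨t₀, ht₀, x₀, hx₀, hmax⟩ := exists_abs_isMaxOn_of_decay h.continuousOn hdecay ht₁ hx₁
    (abs_pos.1 (hN0.trans_lt hlt))
  have hNlt : N < |φ t₀ x₀| := hlt.trans_le (hmax t₁ ht₁ x₁ hx₁)
  have hne : φ t₀ x₀ ≠ 0 := abs_pos.1 (hN0.trans_lt hNlt)
  have hx₀' : 0 < x₀ := hx₀.lt_of_ne fun h0 => hne (h0 ▸ h.boundary t₀ ht₀)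
  have ht₀' : a < t₀ := ht₀.1.lt_of_ne fun h0 => (hN x₀ hx₀).not_gt (h0 ▸ hNlt)
  obtain ⟨φt, φx, hφt, hφx, heq⟩ := h.equation t₀ ht₀ x₀ hx₀'
  have hspace : 2 * φ t₀ x₀ * φx = 0 := by
    have hloc : IsLocalMax (fun x => φ t₀ x ^ 2) x₀ := by
      filter_upwards [Ioi_mem_nhds hx₀'] with x hx
      exact sq_le_sq.2 (hmax t₀ ht₀ x (le_of_lt hx))
    simpa using hloc.hasDerivAt_eq_zero (hφx.pow 2)
  have htime : 0 ≤ 2 * φ t₀ x₀ * φt := by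
    simpa using hasDerivWithinAt_nonneg_of_forall_le (hφt.pow 2) ht₀' ht₀.2
      fun s hs => sq_le_sq.2 (hmax s hs x₀ hx₀)
  refine (hf t₀ ht₀ x₀ hx₀' hne (hmax t₀ ht₀)).not_ge ?_
  rw [← heq]
  linear_combination (1 / 2) * htime - b t₀ x₀ / 2 * hspace

theorem dampingFactor_pos {x : ℝ} (hLx : 0 < L + x) : 0 < dampingFactor a l L p t x := by
  unfold dampingFactor
  positivity

theorem abs_dampingFactor_mul_le_iff {x y : ℝ} (hLx : 0 < L + x) :
    |dampingFactor a l L p t x * y| ≤ N ↔ |y| ≤ N * Real.exp (l * (t - a)) * (L + x) ^ p := by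
  have hinv : dampingFactor a l L p t x = (Real.exp (l * (t - a)) * (L + x) ^ p)⁻¹ := by
    rw [dampingFactor, Real.exp_neg, Real.rpow_neg hLx.le, mul_inv]
  have hpos : 0 < Real.exp (l * (t - a)) * (L + x) ^ p := by positivity
  rw [abs_mul, abs_of_pos (dampingFactor_pos hLx), hinv, inv_mul_le_iff₀ hpos, mul_comm _ N,
    mul_assoc]

theorem IsTransport.dampingFactor_mul (h : IsTransport a c b f φ) (hL : 0 < L) (l p : ℝ) :
    IsTransport a c b
      (fun t x => dampingFactor a l L p t x * (f t x - (l + p * (b t x / (L + x))) * φ t x))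
      (fun t x => dampingFactor a l L p t x * φ t x) := by
  unfold dampingFactor
  refine ⟨?_, fun t ht => by simp [h.boundary t ht], fun t ht x hx => ?_⟩
  · refine (ContinuousOn.mul (by fun_prop) ?_).mul h.continuousOn
    refine ContinuousOn.rpow_const (by fun_prop) fun z hz => Or.inl ?_
    exact (add_pos_of_pos_of_nonneg hL hz.2).ne'
  · have hLx : 0 < L + x := by linarith
    obtain ⟨φt, φx, h1, h2, h3⟩ := h.equation t ht x hx
    have hexp := (((((hasDerivAt_id t).sub_const a).const_mul l).neg.exp).mul_const
      ((L + x) ^ (-p))).hasDerivWithinAt (s := Icc a c)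
    have hpow := (((hasDerivAt_id x).const_add L).rpow_const (p := -p) (Or.inl hLx.ne')).const_mul
      (Real.exp (-(l * (t - a))))
    refine ⟨_, _, hexp.mul h1, hpow.mul h2, ?_⟩
    simp only [← h3, id_eq, Pi.neg_apply, Real.rpow_sub_one hLx.ne']
    field_simp
    ring

theorem eventually_abs_dampingFactor_mul_lt (hqp : q < p)
    (hgrowth : ∀ t ∈ Icc a c, WeightedBound L q N (φ t)) (hL : 0 < L) :
    ∀ ε > 0, ∀ᶠ x in atTop, ∀ t ∈ Icc a c, |dampingFactor a l L p t x * φ t x| < ε := by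
  intro ε hε
  have hlim : Tendsto (fun x : ℝ => Real.exp (|l| * (c - a)) * N * (L + x) ^ (-(p - q))) atTop
      (𝓝 (Real.exp (|l| * (c - a)) * N * 0)) :=
    ((tendsto_rpow_neg_atTop (sub_pos.2 hqp)).comp
      (tendsto_atTop_add_const_left _ _ tendsto_id)).const_mul _
  rw [mul_zero] at hlim
  filter_upwards [hlim.eventually_lt_const hε, eventually_ge_atTop 0] with x hxε hx t ht
  have hLx : 0 < L + x := by linarith
  refine lt_of_le_of_lt ?_ hxε
  have hexp : -(l * (t - a)) ≤ |l| * (c - a) := by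
    have h0 : 0 ≤ t - a := sub_nonneg.2 ht.1
    calc -(l * (t - a)) = -l * (t - a) := by ring
      _ ≤ |l| * (c - a) := by gcongr; exacts [neg_le_abs l, ht.2]
  rw [abs_mul, abs_of_pos (dampingFactor_pos hLx), dampingFactor]
  calc Real.exp (-(l * (t - a))) * (L + x) ^ (-p) * |φ t x|
      ≤ Real.exp (|l| * (c - a)) * (L + x) ^ (-p) * (N * (L + x) ^ q) := by
        gcongr
        exact hgrowth t ht hx
    _ = Real.exp (|l| * (c - a)) * N * ((L + x) ^ (-p) * (L + x) ^ q) := by ring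
    _ = _ := by rw [← Real.rpow_add hLx, neg_add_eq_sub, neg_sub]

/-- The damped function solves a transport equation whose source is dominated by `-l φ`. -/
theorem IsTransport.weightedBound_of_source_le (h : IsTransport a c b f φ) (hL : 0 < L)
    (hqp : q < p) (hp : 0 ≤ p) (hgrowth : ∀ t ∈ Icc a c, WeightedBound L q N (φ t))
    (hb : ∀ t ∈ Icc a c, ∀ x, 0 < x → |b t x| ≤ B * (L + x))
    (hf : ∀ t ∈ Icc a c, ∀ K, WeightedBound L p K (φ t) → ∀ x, 0 < x →
      |f t x| ≤ R * K * (L + x) ^ p)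
    (hN₀ : WeightedBound L p N₀ (φ a)) (hl : p * B + R < l) :
    ∀ t ∈ Icc a c, WeightedBound L p (N₀ * Real.exp (l * (t - a))) (φ t) := by
  suffices hdamped : ∀ t ∈ Icc a c, ∀ x, 0 ≤ x → |dampingFactor a l L p t x * φ t x| ≤ N₀ from
    fun t ht x hx => (abs_dampingFactor_mul_le_iff (by linarith)).1 (hdamped t ht x hx)
  refine (h.dampingFactor_mul hL l p).abs_le_of_source_inward
    (eventually_abs_dampingFactor_mul_lt hqp hgrowth hL) (fun t ht x hx hne hmax => ?_)
    fun x hx => (abs_dampingFactor_mul_le_iff (by linarith)).2 (by simpa using hN₀ hx)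
  have hLx : 0 < L + x := by linarith
  set w := dampingFactor a l L p t x
  have hw : 0 < w := dampingFactor_pos hLx
  have hφ : |φ t x| ≠ 0 := abs_ne_zero.2 (right_ne_zero_of_mul hne)
  have hsource : |w * f t x| ≤ R * |w * φ t x| := by
    refine (abs_dampingFactor_mul_le_iff hLx).2 ((hf t ht _ (fun y hy =>
      (abs_dampingFactor_mul_le_iff (by linarith)).1 (hmax y hy)) x hx).trans_eq ?_)
    ring
  have hdrift : -(p * B) ≤ p * (b t x / (L + x)) := by
    have : -B ≤ b t x / (L + x) := by
      rw [le_div_iff₀ hLx]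
      linarith [(abs_le.1 (hb t ht x hx)).1]
    nlinarith
  have hsource' : f t x * φ t x ≤ R * φ t x ^ 2 := by
    rw [abs_mul, abs_mul, abs_of_pos hw, mul_left_comm] at hsource
    calc f t x * φ t x ≤ |f t x| * |φ t x| := (le_abs_self _).trans_eq (abs_mul _ _)
      _ ≤ R * |φ t x| * |φ t x| := by gcongr; exact le_of_mul_le_mul_left hsource hw
      _ = R * φ t x ^ 2 := by rw [mul_assoc, abs_mul_abs_self, sq]
  have hneg : (f t x - (l + p * (b t x / (L + x))) * φ t x) * φ t x < 0 := by
    have := sq_pos_of_ne_zero (abs_ne_zero.1 hφ)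
    nlinarith
  nlinarith [mul_pos hw hw]

theorem IsTransport.weightedBound_of_homogeneous (h : IsTransport a c b (fun _ _ => 0) φ)
    (hL : 1 ≤ L) (hq : 0 ≤ q) (hgrowth : ∀ t ∈ Icc a c, WeightedBound L q N (φ t))
    (hb : ∀ t ∈ Icc a c, ∀ x, 0 < x → |b t x| ≤ B * (L + x))
    (hN₀ : WeightedBound L q N₀ (φ a)) :
    ∀ t ∈ Icc a c, WeightedBound L q (N₀ * Real.exp (q * B * (t - a))) (φ t) := by
  intro t ht x hx
  have hLx : 0 < L + x := by linarith
  have hlim : Tendsto (fun p => N₀ * Real.exp ((p * B + (p - q)) * (t - a)) * (L + x) ^ p) (𝓝[>] q)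
      (𝓝 (N₀ * Real.exp ((q * B + (q - q)) * (t - a)) * (L + x) ^ q)) := by
    refine (Continuous.tendsto (Continuous.mul (by fun_prop) ?_) _).mono_left nhdsWithin_le_nhds
    exact continuous_const.rpow continuous_id fun _ => Or.inl hLx.ne'
  rw [sub_self, add_zero] at hlim
  refine ge_of_tendsto hlim (eventually_nhdsWithin_of_forall fun p (hp : q < p) => ?_)
  exact h.weightedBound_of_source_le (R := 0) (by linarith) hp (hq.trans hp.le) hgrowth hb
    (fun _ _ _ _ _ _ => by simp) (hN₀.mono hL hp.le) (by linarith) t ht hx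

end maximumPrinciple

/-! ### A Baire category argument for uniform bounds -/

section Baire

variable {X : Type*} [TopologicalSpace X] {E : ℕ → Set X} {I : Set X}

/-- The points of `I` near which `I` is not contained in a single member of the sequence `E`. For
`E n = {t | ‖φ t‖ ≤ n}` these are the points where `t ↦ ‖φ t‖` is not locally bounded. -/
def badSet (E : ℕ → Set X) (I : Set X) : Set X :=
  {t ∈ I | ∀ m, E m ∉ 𝓝[I] t}

theorem isClosed_badSet (hI : IsClosed I) : IsClosed (badSet E I) := by
  refine isClosed_of_closure_subset fun t ht => ?_
  have htI : t ∈ I := closure_minimal (fun s hs => hs.1) hI ht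
  refine ⟨htI, fun m hm => ?_⟩
  obtain ⟨U, hUo, htU, hU⟩ := mem_nhdsWithin.1 hm
  obtain ⟨s, hsU, hsB⟩ := mem_closure_iff.1 ht U hUo htU
  exact hsB.2 m (mem_nhdsWithin.2 ⟨U, hUo, hsU, hU⟩)

theorem exists_subset_of_disjoint_badSet (hmono : Monotone E) {K : Set X} (hK : IsCompact K)
    (hKI : K ⊆ I) (hdisj : Disjoint K (badSet E I)) : ∃ m, K ⊆ E m := by
  refine hK.induction_on (p := fun s => ∃ m, s ⊆ E m) ⟨0, empty_subset _⟩
    (fun s t hst ⟨m, hm⟩ => ⟨m, hst.trans hm⟩) ?_ fun t ht => ?_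
  · rintro s t ⟨m, hm⟩ ⟨n, hn⟩
    exact ⟨max m n, union_subset (hm.trans (hmono (le_max_left _ _)))
      (hn.trans (hmono (le_max_right _ _)))⟩
  · by_contra! h
    exact disjoint_left.1 hdisj ht
      ⟨hKI ht, fun m hm => h _ (nhdsWithin_mono t hKI hm) m Subset.rfl⟩

theorem exists_mem_nhdsWithin_of_isClosed_cover {X : Type*} [MetricSpace X] [CompleteSpace X]
    {E : ℕ → Set X} {B : Set X} (hB : IsClosed B) (hne : B.Nonempty)
    (hclosed : ∀ n, IsClosed (E n ∩ B)) (hcover : ∀ t ∈ B, ∃ n, t ∈ E n) :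
    ∃ n, ∃ t ∈ B, E n ∈ 𝓝[B] t := by
  have : CompleteSpace B := hB.completeSpace_coe
  have : Nonempty B := hne.to_subtype
  have hpre : ∀ n, ((↑) : B → X) ⁻¹' (E n ∩ B) = (↑) ⁻¹' E n := fun n => by simp
  obtain ⟨n, t, ht⟩ := nonempty_interior_of_iUnion_of_closed (f := fun n => ((↑) : B → X) ⁻¹' E n)
    (fun n => hpre n ▸ (hclosed n).preimage continuous_subtype_val)
    (eq_univ_of_forall fun t => mem_iUnion.2 (hcover t t.2))
  exact ⟨n, t, t.2, preimage_coe_mem_nhds_subtype.1 (mem_interior_iff_mem_nhds.1 ht)⟩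

end Baire

section endpointControl

variable {I : Set ℝ} {E : ℕ → Set ℝ} {F : ℕ → ℕ}

/-- The bad point `b` nearest to `s` is reached from `s` through good points, so some `E k` contains
the whole interval from `s` to `b`; control at the endpoint `b` then improves `k` to `F n`. -/
theorem mem_of_forall_badSet_mem (hmono : Monotone E) (hI : IsClosed I)
    (hclosed : ∀ n, IsClosed (E n ∩ I)) (hcover : ∀ t ∈ I, ∃ n, t ∈ E n)
    (hF : ∀ a c n m, uIcc a c ⊆ I → a ∈ E n → uIcc a c ⊆ E m → uIcc a c ⊆ E (F n))
    {n : ℕ} {s t : ℝ} (hst : uIcc s t ⊆ I) (ht : t ∈ badSet E I) (hs : s ∉ badSet E I)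
    (hbad : ∀ r ∈ badSet E I ∩ uIcc s t, r ∈ E n) : s ∈ E (F n) := by
  have hcompact : IsCompact (badSet E I ∩ uIcc s t) :=
    isCompact_uIcc.inter_left (isClosed_badSet hI)
  obtain ⟨b, ⟨hbB, hbst⟩, hmin⟩ := hcompact.exists_isMinOn ⟨t, ht, right_mem_uIcc⟩
    (f := fun r => |r - s|) (by fun_prop)
  have hsb : s ≠ b := fun h => hs (h ▸ hbB)
  have hsubst : uIcc s b ⊆ uIcc s t := uIcc_subset_uIcc_left hbst
  obtain ⟨k, hk⟩ := hcover s (hst left_mem_uIcc)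
  have hinterior : Ioo (min s b) (max s b) ⊆ E (F k) ∩ I := by
    intro d hd
    have hdb : d ∈ uIcc s b := Ioo_subset_Icc_self hd
    have hdI : uIcc s d ⊆ I := (uIcc_subset_uIcc_left hdb).trans (hsubst.trans hst)
    have hlt : |d - s| < |b - s| := by
      rcases lt_or_gt_of_ne hsb with h | h <;> simp only [h.le, inf_of_le_left, inf_of_le_right,
        sup_of_le_left, sup_of_le_right, mem_Ioo] at hd
      · rw [abs_of_pos (sub_pos.2 hd.1), abs_of_pos (sub_pos.2 h)]
        linarith
      · rw [abs_of_neg (sub_neg.2 hd.2), abs_of_neg (sub_neg.2 h)]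
        linarith
    obtain ⟨m, hm⟩ := exists_subset_of_disjoint_badSet hmono isCompact_uIcc hdI
      (disjoint_left.2 fun r hr hrB => ((abs_sub_left_of_mem_uIcc hr).trans_lt hlt).not_ge
        (hmin ⟨hrB, hsubst (uIcc_subset_uIcc_left hdb hr)⟩))
    exact ⟨hF s d k m hdI hk hm right_mem_uIcc, hdI right_mem_uIcc⟩
  have hsub : uIcc s b ⊆ E (F k) := by
    rw [uIcc, ← closure_Ioo (inf_lt_sup.2 hsb).ne]
    exact (closure_minimal hinterior (hclosed _)).trans inter_subset_left
  rw [uIcc_comm] at hsub hsubst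
  exact hF b s n _ (hsubst.trans hst) (hbad b ⟨hbB, hbst⟩) hsub right_mem_uIcc

/-- If the bad set were nonempty then, by Baire's theorem, some `E n` would contain its part near
one of its points `t`, and hence `E (F n)` all points near `t`. -/
theorem exists_subset_of_endpoint_control (hmono : Monotone E) (hI : IsCompact I)
    (hord : I.OrdConnected) (hclosed : ∀ n, IsClosed (E n ∩ I)) (hcover : ∀ t ∈ I, ∃ n, t ∈ E n)
    (hF : ∀ a c n m, uIcc a c ⊆ I → a ∈ E n → uIcc a c ⊆ E m → uIcc a c ⊆ E (F n)) :
    ∃ m, I ⊆ E m := by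
  by_contra hcon
  have hBsub : badSet E I ⊆ I := fun s hs => hs.1
  have hBclosed : IsClosed (badSet E I) := isClosed_badSet hI.isClosed
  have hBne : (badSet E I).Nonempty := by
    by_contra hne
    exact hcon (exists_subset_of_disjoint_badSet hmono hI Subset.rfl
      (not_nonempty_iff_eq_empty.1 hne ▸ disjoint_empty I))
  obtain ⟨n, t, htB, hn⟩ := exists_mem_nhdsWithin_of_isClosed_cover hBclosed hBne
    (fun n => by
      rw [← inter_eq_self_of_subset_right hBsub, ← inter_assoc]
      exact (hclosed n).inter hBclosed)
    fun s hs => hcover s (hBsub hs)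
  obtain ⟨ε, hε, hball⟩ := Metric.mem_nhdsWithin_iff.1 hn
  refine htB.2 (max n (F n)) (Metric.mem_nhdsWithin_iff.2 ⟨ε, hε, fun s ⟨hst, hsI⟩ => ?_⟩)
  by_cases hsB : s ∈ badSet E I
  · exact hmono (le_max_left _ _) (hball ⟨hst, hsB⟩)
  · have hsub : uIcc s t ⊆ Metric.ball t ε :=
      (convex_ball t ε).ordConnected.uIcc_subset hst (Metric.mem_ball_self hε)
    exact hmono (le_max_right _ _) (mem_of_forall_badSet_mem hmono hI.isClosed hclosed hcover hF
      (hord.uIcc_subset hsI htB.1) htB hsB fun r hr => hball ⟨hsub hr.2, hr.1⟩)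

end endpointControl

/-! ### Bounds for the velocity -/

section kernelPrimitive

variable {γ : ℝ}

theorem intervalIntegrable_abs_rpow_neg (hγ : γ < 1) (a b : ℝ) :
    IntervalIntegrable (fun s : ℝ => |s| ^ (-γ)) volume a b := by
  have hnonneg : ∀ c : ℝ, 0 ≤ c → IntervalIntegrable (fun s : ℝ => |s| ^ (-γ)) volume 0 c := by
    intro c hc
    refine (intervalIntegral.intervalIntegrable_rpow' (a := 0) (b := c)
      (by linarith : -1 < -γ)).congr fun s hs => ?_
    rw [uIoc_of_le hc] at hs
    simp only [abs_of_pos hs.1]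
  have hzero : ∀ c : ℝ, IntervalIntegrable (fun s : ℝ => |s| ^ (-γ)) volume 0 c := by
    intro c
    rcases le_total 0 c with hc | hc
    · exact hnonneg c hc
    · rw [IntervalIntegrable.iff_comp_neg]
      simpa using hnonneg (-c) (by linarith)
  exact (hzero a).symm.trans (hzero b)

theorem intervalIntegrable_abs_sub_rpow_neg (hγ : γ < 1) (z a b : ℝ) :
    IntervalIntegrable (fun s : ℝ => |s - z| ^ (-γ)) volume a b := by
  simpa using (intervalIntegrable_abs_rpow_neg hγ (a - z) (b - z)).comp_sub_right z

/-- The odd primitive of the Riesz kernel `|·|^{-γ}`. -/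
def kernelPrimitive (γ z : ℝ) : ℝ := ∫ s in (0 : ℝ)..z, |s| ^ (-γ)

theorem kernelPrimitive_of_nonneg {z : ℝ} (hγ : γ < 1) (hz : 0 ≤ z) :
    kernelPrimitive γ z = z ^ (1 - γ) / (1 - γ) := by
  have habs : kernelPrimitive γ z = ∫ s in (0 : ℝ)..z, s ^ (-γ) := by
    refine intervalIntegral.integral_congr fun s hs => ?_
    rw [uIcc_of_le hz] at hs
    simp only [abs_of_nonneg hs.1]
  rw [habs, integral_rpow (Or.inl (by linarith)), Real.zero_rpow (by linarith), sub_zero,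
    neg_add_eq_sub]

theorem kernelPrimitive_neg (γ z : ℝ) : kernelPrimitive γ (-z) = -kernelPrimitive γ z := by
  have h := intervalIntegral.integral_comp_neg (a := 0) (b := z) (fun s : ℝ => |s| ^ (-γ))
  simp only [abs_neg, neg_zero] at h
  rw [kernelPrimitive, kernelPrimitive, h, intervalIntegral.integral_symm]

theorem integral_abs_sub_rpow_neg (hγ : γ < 1) (z a b : ℝ) :
    ∫ s in a..b, |s - z| ^ (-γ) = kernelPrimitive γ (b - z) - kernelPrimitive γ (a - z) := by
  rw [intervalIntegral.integral_comp_sub_right (fun s : ℝ => |s| ^ (-γ)) z, kernelPrimitive,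
    kernelPrimitive, intervalIntegral.integral_interval_sub_left
      (intervalIntegrable_abs_rpow_neg hγ _ _) (intervalIntegrable_abs_rpow_neg hγ _ _)]

end kernelPrimitive

theorem mul_rpow_le_mul_rpow {c x p : ℝ} (hc : 1 ≤ c) (hx : 0 ≤ x) (hp : p ≤ 1) :
    (c * x) ^ p ≤ c * x ^ p := by
  rw [Real.mul_rpow (by linarith) hx]
  gcongr
  exact (Real.rpow_le_rpow_of_exponent_le hc hp).trans_eq (Real.rpow_one c)

theorem abs_rpow_neg_sub_rpow_neg_le {γ m a b : ℝ} (hγ : 0 ≤ γ) (hm : 0 < m) (ha : m ≤ a)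
    (hb : m ≤ b) : |a ^ (-γ) - b ^ (-γ)| ≤ γ * m ^ (-γ - 1) * |a - b| := by
  refine (convex_Ici m).norm_image_sub_le_of_norm_hasDerivWithin_le (f := fun x : ℝ => x ^ (-γ))
    (fun x hx => (Real.hasDerivAt_rpow_const (Or.inl (hm.trans_le hx).ne')).hasDerivWithinAt)
    (fun x hx => ?_) hb ha
  have hx0 : 0 < x := hm.trans_le hx
  rw [Real.norm_eq_abs, abs_mul, abs_neg, abs_of_nonneg hγ, abs_of_pos (Real.rpow_pos_of_pos hx0 _)]
  exact mul_le_mul_of_nonneg_left (Real.rpow_le_rpow_of_nonpos hm hx (by linarith)) hγ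

section kernel

variable {γ p L N x y : ℝ} {f : ℝ → ℝ}

theorem kernel_eq (γ x y : ℝ) : kernel γ x y = |y - x| ^ (-γ) - |x + y| ^ (-γ) := by
  simp only [kernel, Real.rpow_neg (abs_nonneg _), one_div]

theorem measurable_kernel (γ x : ℝ) : Measurable (kernel γ x) := by
  unfold kernel
  fun_prop

theorem abs_kernel_le_near (hγ : 0 ≤ γ) (hx : 0 ≤ x) (hy : 0 < y) :
    |kernel γ x y| ≤ |y - x| ^ (-γ) + |y| ^ (-γ) := by
  have hle : |x + y| ^ (-γ) ≤ |y| ^ (-γ) := by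
    refine Real.rpow_le_rpow_of_nonpos (abs_pos.2 hy.ne') ?_ (neg_nonpos.2 hγ)
    rw [abs_of_pos hy, abs_of_pos (by linarith)]
    linarith
  rw [kernel_eq]
  calc |(|y - x| ^ (-γ) - |x + y| ^ (-γ))| ≤ |(|y - x| ^ (-γ))| + |(|x + y| ^ (-γ))| :=
        abs_sub _ _
    _ = |y - x| ^ (-γ) + |x + y| ^ (-γ) := by
        simp only [abs_of_nonneg (Real.rpow_nonneg (abs_nonneg _) _)]
    _ ≤ |y - x| ^ (-γ) + |y| ^ (-γ) := by gcongr

theorem abs_kernel_le_far (hγ : 0 ≤ γ) (hγ1 : γ ≤ 1) (hx : 0 ≤ x) (hy : 0 < y) (hxy : 2 * x ≤ y) :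
    |kernel γ x y| ≤ 8 * x * y ^ (-γ - 1) := by
  have hhalf : (y / 2) ^ (-γ - 1) ≤ 4 * y ^ (-γ - 1) := by
    rw [Real.div_rpow hy.le zero_le_two, div_eq_mul_inv, ← Real.rpow_neg zero_le_two, mul_comm]
    gcongr
    calc (2 : ℝ) ^ (-(-γ - 1)) ≤ 2 ^ (2 : ℝ) :=
          Real.rpow_le_rpow_of_exponent_le one_le_two (by linarith)
      _ = 4 := by norm_num
  have hdist : |y - x - (x + y)| = 2 * x := by
    rw [show y - x - (x + y) = -(2 * x) by ring, abs_neg, abs_of_nonneg (by linarith)]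
  rw [kernel_eq, abs_of_nonneg (by linarith : 0 ≤ y - x), abs_of_nonneg (by linarith : 0 ≤ x + y)]
  calc |(y - x) ^ (-γ) - (x + y) ^ (-γ)|
      ≤ γ * (y / 2) ^ (-γ - 1) * |y - x - (x + y)| :=
        abs_rpow_neg_sub_rpow_neg_le hγ (half_pos hy) (by linarith) (by linarith)
    _ ≤ 1 * (4 * y ^ (-γ - 1)) * (2 * x) := by rw [hdist]; gcongr
    _ = _ := by ring

theorem abs_kernel_mul_le_near (hγ1 : γ < 1) (hp : 0 ≤ p) (hpγ : p < γ) (hL : 0 < L)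
    (hf : WeightedBound L p N f) (hx : 0 ≤ x) (hy : y ∈ Ioc 0 (2 * (L + x))) :
    ‖kernel γ x y * f y‖ ≤ 3 * N * (L + x) ^ p * (|y - x| ^ (-γ) + |y| ^ (-γ)) := by
  have hN : 0 ≤ N := hf.nonneg hL
  obtain ⟨hy0, hyx⟩ := hy
  have hfy : |f y| ≤ 3 * N * (L + x) ^ p := by
    calc |f y| ≤ N * (L + y) ^ p := hf hy0.le
      _ ≤ N * (3 * (L + x)) ^ p := by gcongr; linarith
      _ ≤ N * (3 * (L + x) ^ p) := by
          gcongr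
          exact mul_rpow_le_mul_rpow (by norm_num) (by linarith) (by linarith)
      _ = _ := by ring
  rw [norm_mul, Real.norm_eq_abs, Real.norm_eq_abs, mul_comm]
  gcongr
  exact abs_kernel_le_near (hp.trans hpγ.le) hx hy0

theorem abs_kernel_mul_le_far (hγ1 : γ < 1) (hp : 0 ≤ p) (hpγ : p < γ) (hL : 0 < L)
    (hf : WeightedBound L p N f) (hx : 0 ≤ x) (hy : 2 * (L + x) < y) :
    ‖kernel γ x y * f y‖ ≤ 16 * N * x * y ^ (p - γ - 1) := by
  have hN : 0 ≤ N := hf.nonneg hL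
  have hy0 : 0 < y := by linarith
  have hfy : |f y| ≤ 2 * N * y ^ p := by
    calc |f y| ≤ N * (L + y) ^ p := hf hy0.le
      _ ≤ N * (2 * y) ^ p := by gcongr; linarith
      _ ≤ N * (2 * y ^ p) := by
          gcongr
          exact mul_rpow_le_mul_rpow one_le_two hy0.le (by linarith)
      _ = _ := by ring
  have hkernel := abs_kernel_le_far (hp.trans hpγ.le) hγ1.le hx hy0 (by linarith)
  rw [norm_mul, Real.norm_eq_abs, Real.norm_eq_abs]
  calc |kernel γ x y| * |f y| ≤ (8 * x * y ^ (-γ - 1)) * (2 * N * y ^ p) := by gcongr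
    _ = 16 * N * x * (y ^ p * y ^ (-γ - 1)) := by ring
    _ = 16 * N * x * y ^ (p - γ - 1) := by rw [← Real.rpow_add hy0]; ring_nf

theorem integrableOn_near_majorant (hγ1 : γ < 1) {R : ℝ} (hR : 0 ≤ R) (x A : ℝ) :
    IntegrableOn (fun y => A * (|y - x| ^ (-γ) + |y| ^ (-γ))) (Ioc 0 R) := by
  rw [← intervalIntegrable_iff_integrableOn_Ioc_of_le hR]
  exact ((intervalIntegrable_abs_sub_rpow_neg hγ1 x 0 R).add
    (intervalIntegrable_abs_rpow_neg hγ1 0 R)).const_mul A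

theorem integrableOn_kernel_mul (hγ1 : γ < 1) (hp : 0 ≤ p) (hpγ : p < γ) (hL : 0 < L)
    (hf : WeightedBound L p N f) (hfm : Measurable f) (hx : 0 ≤ x) :
    IntegrableOn (fun y => kernel γ x y * f y) (Ioi 0) := by
  have hR : 0 < 2 * (L + x) := by linarith
  have hmeas := ((measurable_kernel γ x).mul hfm).aestronglyMeasurable (μ := volume)
  rw [← Ioc_union_Ioi_eq_Ioi hR.le]
  refine IntegrableOn.union ?_ ?_
  · exact (integrableOn_near_majorant hγ1 hR.le x _).mono' hmeas.restrict
      (ae_restrict_of_forall_mem measurableSet_Ioc fun y hy =>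
        abs_kernel_mul_le_near hγ1 hp hpγ hL hf hx hy)
  · exact ((integrableOn_Ioi_rpow_of_lt (by linarith) hR).const_mul _).mono' hmeas.restrict
      (ae_restrict_of_forall_mem measurableSet_Ioi fun y hy =>
        abs_kernel_mul_le_far hγ1 hp hpγ hL hf hx hy)

theorem integral_near_majorant_le (hγ1 : γ < 1) {R : ℝ} (hx : 0 ≤ x) (hxR : x ≤ R) :
    ∫ y in Ioc 0 R, (|y - x| ^ (-γ) + |y| ^ (-γ)) ≤ 3 * (R ^ (1 - γ) / (1 - γ)) := by
  have := sub_pos.2 hγ1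
  have hprim : ∀ z, 0 ≤ z → z ≤ R → kernelPrimitive γ z ≤ R ^ (1 - γ) / (1 - γ) := by
    intro z hz hzR
    rw [kernelPrimitive_of_nonneg hγ1 hz]
    gcongr
  have hintegral : ∫ y in Ioc 0 R, (|y - x| ^ (-γ) + |y| ^ (-γ)) =
      kernelPrimitive γ (R - x) + kernelPrimitive γ x + kernelPrimitive γ R := by
    rw [← intervalIntegral.integral_of_le (hx.trans hxR), intervalIntegral.integral_add
      (intervalIntegrable_abs_sub_rpow_neg hγ1 x 0 R) (intervalIntegrable_abs_rpow_neg hγ1 0 R),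
      integral_abs_sub_rpow_neg hγ1, zero_sub, kernelPrimitive_neg, sub_neg_eq_add]
    rfl
  linarith [hprim (R - x) (by linarith) (by linarith), hprim x hx hxR,
    hprim R (hx.trans hxR) le_rfl]

theorem norm_integral_kernel_mul_near_le (hγ1 : γ < 1) (hp : 0 ≤ p) (hpγ : p < γ) (hL : 0 < L)
    (hf : WeightedBound L p N f) (hx : 0 ≤ x) :
    ‖∫ y in Ioc 0 (2 * (L + x)), kernel γ x y * f y‖ ≤
      18 / (1 - γ) * N * (L + x) ^ (1 - γ + p) := by
  have hN : 0 ≤ N := hf.nonneg hL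
  have hS : 0 < L + x := by linarith
  have := sub_pos.2 hγ1
  calc ‖∫ y in Ioc 0 (2 * (L + x)), kernel γ x y * f y‖
      ≤ ∫ y in Ioc 0 (2 * (L + x)), 3 * N * (L + x) ^ p * (|y - x| ^ (-γ) + |y| ^ (-γ)) :=
        norm_integral_le_of_norm_le (integrableOn_near_majorant hγ1 (by linarith) x _)
          (ae_restrict_of_forall_mem measurableSet_Ioc fun y hy =>
            abs_kernel_mul_le_near hγ1 hp hpγ hL hf hx hy)
    _ ≤ 3 * N * (L + x) ^ p * (3 * ((2 * (L + x)) ^ (1 - γ) / (1 - γ))) := by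
        rw [integral_const_mul]
        gcongr
        exact integral_near_majorant_le hγ1 hx (by linarith)
    _ ≤ 3 * N * (L + x) ^ p * (3 * (2 * (L + x) ^ (1 - γ) / (1 - γ))) := by
        gcongr
        exact mul_rpow_le_mul_rpow one_le_two hS.le (by linarith)
    _ = 18 / (1 - γ) * N * ((L + x) ^ (1 - γ) * (L + x) ^ p) := by ring
    _ = _ := by rw [← Real.rpow_add hS]

theorem norm_integral_kernel_mul_far_le (hγ1 : γ < 1) (hp : 0 ≤ p) (hpγ : p < γ) (hL : 0 < L)
    (hf : WeightedBound L p N f) (hx : 0 ≤ x) :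
    ‖∫ y in Ioi (2 * (L + x)), kernel γ x y * f y‖ ≤
      16 / (γ - p) * N * (L + x) ^ (1 - γ + p) := by
  have hN : 0 ≤ N := hf.nonneg hL
  have hS : 0 < L + x := by linarith
  have := sub_pos.2 hpγ
  have hexp : p - γ - 1 < -1 := by linarith
  calc ‖∫ y in Ioi (2 * (L + x)), kernel γ x y * f y‖
      ≤ ∫ y in Ioi (2 * (L + x)), 16 * N * x * y ^ (p - γ - 1) :=
        norm_integral_le_of_norm_le
          ((integrableOn_Ioi_rpow_of_lt hexp (by linarith)).const_mul _)
          (ae_restrict_of_forall_mem measurableSet_Ioi fun y hy =>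
            abs_kernel_mul_le_far hγ1 hp hpγ hL hf hx hy)
    _ = 16 * N * x * ((2 * (L + x)) ^ (p - γ) / (γ - p)) := by
        rw [integral_const_mul, integral_Ioi_rpow_of_lt hexp (by linarith), sub_add_cancel,
          ← neg_sub γ p, neg_div_neg_eq]
    _ ≤ 16 * N * (L + x) * ((L + x) ^ (p - γ) / (γ - p)) := by
        gcongr ?_ * _ * ?_ * (?_ / _)
        · linarith
        · exact Real.rpow_le_rpow_of_nonpos hS (by linarith) (by linarith)
    _ = 16 / (γ - p) * N * ((L + x) ^ (p - γ) * (L + x)) := by ring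
    _ = _ := by rw [← Real.rpow_add_one hS.ne']; ring_nf

/-- The constant in the bound `|u[f](x)| ≤ C N (L + x)^{1 - γ + p}` for `|f| ≤ N (L + x)^p`; its two
terms come from `y ≤ 2 (L + x)` and from `y > 2 (L + x)`. -/
def velocityConst (γ p : ℝ) : ℝ := 18 / (1 - γ) + 16 / (γ - p)

theorem velocityConst_pos (hγ1 : γ < 1) (hpγ : p < γ) : 0 < velocityConst γ p :=
  add_pos (div_pos (by norm_num) (sub_pos.2 hγ1)) (div_pos (by norm_num) (sub_pos.2 hpγ))

theorem abs_velocity_le (hγ1 : γ < 1) (hp : 0 ≤ p) (hpγ : p < γ) (hL : 0 < L)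
    (hf : WeightedBound L p N f) (hfm : Measurable f) (hx : 0 ≤ x) :
    |velocity γ f x| ≤ velocityConst γ p * N * (L + x) ^ (1 - γ + p) := by
  have hR : 0 ≤ 2 * (L + x) := by linarith
  have hint := integrableOn_kernel_mul hγ1 hp hpγ hL hf hfm hx
  rw [velocity, abs_neg, ← Ioc_union_Ioi_eq_Ioi hR, setIntegral_union (Ioc_disjoint_Ioi le_rfl)
    measurableSet_Ioi (hint.mono_set Ioc_subset_Ioi_self) (hint.mono_set (Ioi_subset_Ioi hR)),
    velocityConst, add_mul, add_mul]
  exact (abs_add_le _ _).trans (add_le_add (norm_integral_kernel_mul_near_le hγ1 hp hpγ hL hf hx)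
    (norm_integral_kernel_mul_far_le hγ1 hp hpγ hL hf hx))

theorem abs_velocity_le_linear (hγ1 : γ < 1) (hp : 0 ≤ p) (hpγ : p < γ) (hL : 0 < L)
    (hf : WeightedBound L p N f) (hfm : Measurable f) (hx : 0 ≤ x) :
    |velocity γ f x| ≤ velocityConst γ p * N * L ^ (p - γ) * (L + x) := by
  have hN : 0 ≤ N := hf.nonneg hL
  have hS : 0 < L + x := by linarith
  have hC := velocityConst_pos hγ1 hpγ
  calc |velocity γ f x| ≤ velocityConst γ p * N * (L + x) ^ (1 - γ + p) :=
        abs_velocity_le hγ1 hp hpγ hL hf hfm hx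
    _ = velocityConst γ p * N * (L + x) ^ (p - γ) * (L + x) := by
        rw [mul_assoc _ ((L + x) ^ (p - γ)), ← Real.rpow_add_one hS.ne']
        ring_nf
    _ ≤ velocityConst γ p * N * L ^ (p - γ) * (L + x) := by
        have hpow : (L + x) ^ (p - γ) ≤ L ^ (p - γ) :=
          Real.rpow_le_rpow_of_nonpos hL (by linarith) (by linarith)
        gcongr

theorem velocity_sub {g : ℝ → ℝ} (hf : IntegrableOn (fun y => kernel γ x y * f y) (Ioi 0))
    (hg : IntegrableOn (fun y => kernel γ x y * g y) (Ioi 0)) :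
    velocity γ (fun y => f y - g y) x = velocity γ f x - velocity γ g x := by
  simp only [velocity, mul_sub]
  rw [integral_sub hf hg]
  ring

end kernel

/-! ### The a priori bound and uniqueness -/

section aprioriBound

variable {γ q p a c L N N₀ K T : ℝ} {b φ : ℝ → ℝ → ℝ} {f : ℝ → ℝ}

theorem weightedNorm_lt_top_iff {s : ℝ} :
    weightedNorm s f < ∞ ↔ ∃ N, WeightedBound 1 s N f := by
  have hiff : ∀ N x : ℝ, 0 ≤ x → (|f x| * (1 + x) ^ (-s) ≤ N ↔ |f x| ≤ N * (1 + x) ^ s) := by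
    intro N x hx
    have hx1 : 0 < 1 + x := by linarith
    rw [Real.rpow_neg hx1.le, ← div_eq_mul_inv, div_le_iff₀ (Real.rpow_pos_of_pos hx1 _)]
  constructor
  · refine fun h => ⟨(weightedNorm s f).toReal, fun x hx => (hiff _ x hx).1 ?_⟩
    exact (ENNReal.ofReal_le_iff_le_toReal h.ne).1
      (le_iSup₂ (f := fun (x : ℝ) (_ : 0 ≤ x) => ENNReal.ofReal (|f x| * (1 + x) ^ (-s))) x hx)
  · rintro ⟨N, hN⟩
    exact (iSup₂_le fun x hx => ENNReal.ofReal_le_ofReal ((hiff N x hx).2 (hN hx))).trans_lt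
      ENNReal.ofReal_lt_top

theorem WeightedBound.of_le (hL : 0 ≤ L) (hNK : N ≤ K) (hf : WeightedBound L p N f) :
    WeightedBound L p K f := fun x hx => by
  have hpow : 0 ≤ (L + x) ^ p := by positivity
  exact (hf hx).trans (mul_le_mul_of_nonneg_right hNK hpow)

theorem WeightedBound.shift_of_one (hp : 0 ≤ p) (hL : 1 ≤ L) (hf : WeightedBound 1 p N f) :
    WeightedBound L p N f := fun x hx => by
  have hN := hf.nonneg one_pos
  exact (hf hx).trans (by gcongr)

theorem WeightedBound.shift_to_one (hp : 0 ≤ p) (hL : 1 ≤ L) (hf : WeightedBound L p N f) :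
    WeightedBound 1 p (N * L ^ p) f := fun x hx => by
  have hL0 : 0 < L := one_pos.trans_le hL
  have hN := hf.nonneg hL0
  calc |f x| ≤ N * (L + x) ^ p := hf hx
    _ ≤ N * (L * (1 + x)) ^ p := by gcongr; nlinarith
    _ = N * L ^ p * (1 + x) ^ p := by rw [Real.mul_rpow hL0.le (by linarith), mul_assoc]

theorem forall_mem_Icc_of_step {P : ℝ → Prop} {η : ℝ} (hη : 0 < η) (ha : P a)
    (hstep : ∀ d ∈ Icc a c, (∀ t ∈ Icc a d, P t) → ∀ t ∈ Icc d c, t ≤ d + η → P t) :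
    ∀ t ∈ Icc a c, P t := by
  have hsteps : ∀ n : ℕ, ∀ t ∈ Icc a c, t ≤ a + n * η → P t := by
    intro n
    induction n with
    | zero => exact fun t ht hta => le_antisymm (by simpa using hta) ht.1 ▸ ha
    | succ n ih =>
      intro t ht hta
      rcases le_total t (a + n * η) with htn | htn
      · exact ih t ht htn
      · refine hstep (a + n * η) ⟨le_add_of_nonneg_right (by positivity), htn.trans ht.2⟩
          (fun s hs => ih s ⟨hs.1, hs.2.trans (htn.trans ht.2)⟩ hs.2) t ⟨htn, ht.2⟩ ?_
        push_cast at hta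
        linarith
  intro t ht
  obtain ⟨n, hn⟩ := exists_nat_ge ((c - a) / η)
  rw [div_le_iff₀ hη] at hn
  exact hsteps n t ht (by linarith [ht.2])

theorem exists_weight_shift (hqγ : q < γ) (T N₀ : ℝ) :
    ∃ L, 1 ≤ L ∧ q * (velocityConst γ q * (2 * N₀) * L ^ (q - γ)) * T ≤ Real.log (3 / 2) := by
  have hlim : Tendsto (fun L : ℝ => q * (velocityConst γ q * (2 * N₀) * L ^ (-(γ - q))) * T) atTop
      (𝓝 (q * (velocityConst γ q * (2 * N₀) * 0) * T)) :=
    (((tendsto_rpow_neg_atTop (sub_pos.2 hqγ)).const_mul _).const_mul _).mul_const _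
  have hlog : (0 : ℝ) < Real.log (3 / 2) := Real.log_pos (by norm_num)
  obtain ⟨L, hL, hL1⟩ :=
    ((hlim.eventually_le_const (u := Real.log (3 / 2)) (by simpa using hlog)).and
      (eventually_ge_atTop 1)).exists
  exact ⟨L, hL1, by simpa using hL⟩

theorem IsTransport.weightedBound_of_velocity (h : IsTransport a c b (fun _ _ => 0) φ)
    (hq : 0 ≤ q) (hqγ : q < γ) (hγ1 : γ < 1) (hL : 1 ≤ L) (hmeas : ∀ t ∈ Icc a c, Measurable (φ t))
    (hb : ∀ t ∈ Icc a c, ∀ x, 0 < x → |b t x| = |velocity γ (φ t) x|)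
    (hK : ∀ t ∈ Icc a c, WeightedBound L q K (φ t)) (hN₀ : WeightedBound L q N₀ (φ a)) :
    ∀ t ∈ Icc a c, WeightedBound L q
      (N₀ * Real.exp (q * (velocityConst γ q * K * L ^ (q - γ)) * (t - a))) (φ t) :=
  h.weightedBound_of_homogeneous hL hq hK (fun t ht x hx => (hb t ht x hx).trans_le
    (abs_velocity_le_linear hγ1 hq hqγ (one_pos.trans_le hL) (hK t ht) (hmeas t ht) hx.le)) hN₀

/-- Bootstrap: while the bound `2 N₀` holds, the choice of `L` improves it to `3 / 2 * N₀`, and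
the crude bound `N` lets it degrade by at most `4 / 3` over the next time step. -/
theorem IsTransport.weightedBound_two_mul (h : IsTransport a c b (fun _ _ => 0) φ)
    (hq : 0 ≤ q) (hqγ : q < γ) (hγ1 : γ < 1) (hL : 1 ≤ L) (hmeas : ∀ t ∈ Icc a c, Measurable (φ t))
    (hb : ∀ t ∈ Icc a c, ∀ x, 0 < x → |b t x| = |velocity γ (φ t) x|)
    (hN : ∀ t ∈ Icc a c, WeightedBound L q N (φ t)) (hN₀ : WeightedBound L q N₀ (φ a))
    (hsmall : q * (velocityConst γ q * (2 * N₀) * L ^ (q - γ)) * (c - a) ≤ Real.log (3 / 2)) :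
    ∀ t ∈ Icc a c, WeightedBound L q (2 * N₀) (φ t) := by
  have hL0 : 0 < L := one_pos.trans_le hL
  have hN₀0 : 0 ≤ N₀ := hN₀.nonneg hL0
  have hC := velocityConst_pos hγ1 hqγ
  set M := q * (velocityConst γ q * N * L ^ (q - γ))
  have hη : 0 < Real.log (4 / 3) / (|M| + 1) :=
    div_pos (Real.log_pos (by norm_num)) (by positivity)
  refine forall_mem_Icc_of_step hη (hN₀.of_le hL0.le (by linarith)) fun d hd hbd t ht htd => ?_
  have hleft : Icc a d ⊆ Icc a c := Icc_subset_Icc_right hd.2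
  have hright : Icc d c ⊆ Icc a c := Icc_subset_Icc_left hd.1
  have himproved : WeightedBound L q (3 / 2 * N₀) (φ d) := by
    refine ((h.mono hleft).weightedBound_of_velocity hq hqγ hγ1 hL (fun s hs => hmeas s (hleft hs))
      (fun s hs => hb s (hleft hs)) hbd hN₀ d ⟨hd.1, le_rfl⟩).of_le hL0.le ?_
    rw [mul_comm]
    gcongr
    rw [← Real.le_log_iff_exp_le (by norm_num)]
    refine le_trans ?_ hsmall
    gcongr
    exact hd.2
  refine ((h.mono hright).weightedBound_of_velocity hq hqγ hγ1 hL (fun s hs => hmeas s (hright hs))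
    (fun s hs => hb s (hright hs)) (fun s hs => hN s (hright hs)) himproved t ht).of_le hL0.le ?_
  have hexp : Real.exp (M * (t - d)) ≤ 4 / 3 := by
    rw [← Real.le_log_iff_exp_le (by norm_num)]
    calc M * (t - d) ≤ (|M| + 1) * (Real.log (4 / 3) / (|M| + 1)) :=
          mul_le_mul (by linarith [le_abs_self M]) (by linarith) (by linarith [ht.1])
            (by positivity)
      _ = Real.log (4 / 3) := by field_simp
  calc 3 / 2 * N₀ * Real.exp (M * (t - d)) ≤ 3 / 2 * N₀ * (4 / 3) := by gcongr
    _ = 2 * N₀ := by ring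

theorem IsTransport.weightedBound_two_mul_uIcc {a₀ c₀ : ℝ}
    (h : IsTransport a₀ c₀ (fun t => velocity γ (φ t)) (fun _ _ => 0) φ)
    (hq : 0 ≤ q) (hqγ : q < γ) (hγ1 : γ < 1) (hL : 1 ≤ L)
    (hmeas : ∀ t ∈ Icc a₀ c₀, Measurable (φ t)) (hsub : uIcc a c ⊆ Icc a₀ c₀)
    (hN : ∀ t ∈ uIcc a c, WeightedBound L q N (φ t)) (hN₀ : WeightedBound L q N₀ (φ a))
    (hsmall : q * (velocityConst γ q * (2 * N₀) * L ^ (q - γ)) * |c - a| ≤ Real.log (3 / 2)) :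
    ∀ t ∈ uIcc a c, WeightedBound L q (2 * N₀) (φ t) := by
  rcases le_total a c with hac | hca
  · rw [uIcc_of_le hac] at hsub hN ⊢
    rw [abs_of_nonneg (sub_nonneg.2 hac)] at hsmall
    exact (h.mono hsub).weightedBound_two_mul hq hqγ hγ1 hL (fun t ht => hmeas t (hsub ht))
      (fun _ _ _ _ => rfl) hN hN₀ hsmall
  · rw [uIcc_of_ge hca] at hsub hN ⊢
    rw [abs_of_nonpos (sub_nonpos.2 hca), neg_sub] at hsmall
    have hrev : ∀ t ∈ Icc c a, c + a - t ∈ Icc c a := fun t ht =>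
      ⟨by linarith [ht.2], by linarith [ht.1]⟩
    have hback : IsTransport c a (fun t x => -velocity γ (φ (c + a - t)) x) (fun _ _ => 0)
        (fun t => φ (c + a - t)) := by
      simpa only [neg_zero] using (h.mono hsub).reverse
    have hbound := hback.weightedBound_two_mul hq hqγ hγ1 hL
      (fun t ht => hmeas _ (hsub (hrev t ht))) (fun _ _ _ _ => abs_neg _)
      (fun t ht => hN _ (hrev t ht)) (by simpa using hN₀) hsmall
    intro t ht
    simpa using hbound _ (hrev t ht)

end aprioriBound

section IsSolution

variable {γ q T : ℝ} {ω₀ : ℝ → ℝ} {ω : ℝ → ℝ → ℝ}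

theorem IsSolution.hasDerivAt (h : IsSolution γ q T ω₀ ω) {t : ℝ} (ht : t ∈ Icc 0 T) (x : ℝ) :
    HasDerivAt (ω t) (deriv (ω t) x) x := by
  have hdiff := h.contDiffOn.differentiableOn one_ne_zero (t, x) ⟨ht, mem_univ _⟩
  have hslice : DifferentiableWithinAt ℝ (fun y : ℝ => (t, y)) univ x := by fun_prop
  exact (differentiableWithinAt_univ.1
    (hdiff.comp x hslice fun y _ => ⟨ht, mem_univ _⟩)).hasDerivAt

theorem IsSolution.hasDerivWithinAt (h : IsSolution γ q T ω₀ ω) {t : ℝ} (ht : t ∈ Icc 0 T)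
    (x : ℝ) : HasDerivWithinAt (fun s => ω s x) (derivWithin (fun s => ω s x) (Icc 0 T) t)
      (Icc 0 T) t := by
  have hdiff := h.contDiffOn.differentiableOn one_ne_zero (t, x) ⟨ht, mem_univ _⟩
  have hslice : DifferentiableWithinAt ℝ (fun s : ℝ => (s, x)) (Icc 0 T) t := by fun_prop
  exact (hdiff.comp t hslice fun s hs => mk_mem_prod hs (mem_univ x)).hasDerivWithinAt

theorem IsSolution.measurable (h : IsSolution γ q T ω₀ ω) {t : ℝ} (ht : t ∈ Icc 0 T) :
    Measurable (ω t) :=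
  (continuous_iff_continuousAt.2 fun x => (h.hasDerivAt ht x).continuousAt).measurable

theorem IsSolution.isTransport (h : IsSolution γ q T ω₀ ω) :
    IsTransport 0 T (fun t => velocity γ (ω t)) (fun _ _ => 0) ω where
  continuousOn := h.contDiffOn.continuousOn.mono (prod_mono_right (subset_univ _))
  boundary t ht := self_eq_neg.1 (by simpa using h.odd t ht 0)
  equation t ht x _ := ⟨_, _, h.hasDerivWithinAt ht x, h.hasDerivAt ht x, h.equation t ht x⟩

theorem IsSolution.isClosed_setOf_weightedBound_inter (h : IsSolution γ q T ω₀ ω) (s N : ℝ) :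
    IsClosed ({t | WeightedBound 1 s N (ω t)} ∩ Icc 0 T) := by
  have hinter : {t | WeightedBound 1 s N (ω t)} ∩ Icc 0 T =
      ⋂ x : Ici (0 : ℝ), Icc 0 T ∩ (fun t => |ω t x|) ⁻¹' Iic (N * (1 + x) ^ s) := by
    ext t
    simp only [mem_inter_iff, mem_iInter, Subtype.forall, mem_Ici, mem_preimage, mem_Iic]
    exact ⟨fun ht x hx => ⟨ht.2, ht.1 hx⟩, fun ht => ⟨fun x hx => (ht x hx).2, (ht 0 le_rfl).1⟩⟩
  rw [hinter]
  refine isClosed_iInter fun x => ContinuousOn.preimage_isClosed_of_isClosed (fun t ht => ?_)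
    isClosed_Icc isClosed_Iic
  exact (h.hasDerivWithinAt ht x).continuousWithinAt.abs

/-- A bound at one time controls the norm on any interval where it is finite, by a constant
depending only on that bound, so Baire's theorem applies. -/
theorem IsSolution.exists_uniform_bound (h : IsSolution γ q T ω₀ ω) (hq : 0 < q) (hqγ : q < γ)
    (hγ1 : γ < 1) : ∃ N, ∀ t ∈ Icc 0 T, WeightedBound 1 q N (ω t) := by
  choose L hL1 hL using fun n : ℕ => exists_weight_shift hqγ T n
  have hmono : Monotone fun n : ℕ => {t | WeightedBound 1 q n (ω t)} :=
    fun m n hmn t ht => WeightedBound.of_le zero_le_one (Nat.cast_le.2 hmn) ht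
  suffices hex : ∃ m : ℕ, Icc 0 T ⊆ {t | WeightedBound 1 q m (ω t)} from
    ⟨_, hex.choose_spec⟩
  refine exists_subset_of_endpoint_control (F := fun n => ⌈2 * n * L n ^ q⌉₊) hmono
    isCompact_Icc ordConnected_Icc (fun n => h.isClosed_setOf_weightedBound_inter q n)
    (fun t ht => ?_) fun a c n m hsub ha hm t ht => ?_
  · obtain ⟨N, hN⟩ := weightedNorm_lt_top_iff.1 (ENNReal.add_lt_top.1 (h.growth t ht)).1
    exact ⟨⌈N⌉₊, hN.of_le zero_le_one (Nat.le_ceil N)⟩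
  · have hac : |c - a| ≤ T := by
      have ha' := hsub left_mem_uIcc
      have hc' := hsub right_mem_uIcc
      exact abs_le.2 ⟨by linarith [hc'.1, ha'.2], by linarith [hc'.2, ha'.1]⟩
    have hsmall : q * (velocityConst γ q * (2 * n) * L n ^ (q - γ)) * |c - a| ≤
        Real.log (3 / 2) := by
      have hC := velocityConst_pos hγ1 hqγ
      have hL0 : 0 < L n := one_pos.trans_le (hL1 n)
      exact le_trans (by gcongr) (hL n)
    have hbound := h.isTransport.weightedBound_two_mul_uIcc hq.le hqγ hγ1 (hL1 n)
      (fun s hs => h.measurable hs) hsub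
      (fun s hs => WeightedBound.shift_of_one hq.le (hL1 n) (hm hs))
      (WeightedBound.shift_of_one hq.le (hL1 n) ha) hsmall t ht
    exact (hbound.shift_to_one hq.le (hL1 n)).of_le zero_le_one (Nat.le_ceil _)

theorem IsSolution.isTransport_sub (hq : 0 ≤ q) (hqγ : q < γ) (hγ1 : γ < 1) {ω₁ ω₂ : ℝ → ℝ → ℝ}
    (h₁ : IsSolution γ q T ω₀ ω₁) (h₂ : IsSolution γ q T ω₀ ω₂) :
    IsTransport 0 T (fun t => velocity γ (ω₂ t))
      (fun t x => -(velocity γ (fun y => ω₂ t y - ω₁ t y) x * deriv (ω₁ t) x))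
      (fun t x => ω₂ t x - ω₁ t x) where
  continuousOn := h₂.isTransport.continuousOn.sub h₁.isTransport.continuousOn
  boundary t ht := by rw [h₁.isTransport.boundary t ht, h₂.isTransport.boundary t ht, sub_zero]
  equation t ht x hx := by
    refine ⟨_, _, (h₂.hasDerivWithinAt ht x).sub (h₁.hasDerivWithinAt ht x),
      (h₂.hasDerivAt ht x).sub (h₁.hasDerivAt ht x), ?_⟩
    have hint : ∀ {ω : ℝ → ℝ → ℝ}, IsSolution γ q T ω₀ ω →
        IntegrableOn (fun y => kernel γ x y * ω t y) (Ioi 0) := fun h => by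
      obtain ⟨N, hN⟩ := weightedNorm_lt_top_iff.1 (ENNReal.add_lt_top.1 (h.growth t ht)).1
      exact integrableOn_kernel_mul hγ1 hq hqγ one_pos hN (h.measurable ht) hx.le
    rw [velocity_sub (hint h₂) (hint h₁)]
    linear_combination h₂.equation t ht x - h₁.equation t ht x

/-- The difference is estimated in a weight of exponent `p ∈ (q, γ)`, where it decays. -/
theorem IsSolution.eq_of_deriv_weightedBound {ω₁ ω₂ : ℝ → ℝ → ℝ} (h₁ : IsSolution γ q T ω₀ ω₁)
    (h₂ : IsSolution γ q T ω₀ ω₂) (hq : 0 < q) (hqγ : q < γ) (hγ1 : γ < 1) {M : ℝ}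
    (hM : ∀ t ∈ Icc 0 T, WeightedBound 1 (q - 1) M (deriv (ω₁ t))) {t : ℝ} (ht : t ∈ Icc 0 T)
    (x : ℝ) : ω₂ t x = ω₁ t x := by
  obtain ⟨N₁, hN₁⟩ := h₁.exists_uniform_bound hq hqγ hγ1
  obtain ⟨N₂, hN₂⟩ := h₂.exists_uniform_bound hq hqγ hγ1
  obtain ⟨p, hqp, hpγ⟩ := exists_between hqγ
  have hp : 0 < p := hq.trans hqp
  have hC := velocityConst_pos hγ1 hpγ
  have hgrowth : ∀ t ∈ Icc 0 T, WeightedBound 1 q (N₂ + N₁) (fun x => ω₂ t x - ω₁ t x) :=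
    fun t ht x hx => (abs_sub _ _).trans
      ((add_le_add (hN₂ t ht hx) (hN₁ t ht hx)).trans_eq (add_mul _ _ _).symm)
  have hsource : ∀ t ∈ Icc 0 T, ∀ K, WeightedBound 1 p K (fun x => ω₂ t x - ω₁ t x) →
      ∀ x, 0 < x → |(-(velocity γ (fun y => ω₂ t y - ω₁ t y) x * deriv (ω₁ t) x))| ≤
        velocityConst γ p * M * K * (1 + x) ^ p := by
    intro t ht K hK x hx
    have hx1 : 0 < 1 + x := by linarith
    have hK0 := hK.nonneg one_pos
    have hM0 := (hM t ht).nonneg one_pos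
    have hvel := abs_velocity_le hγ1 hp.le hpγ one_pos hK
      ((h₂.measurable ht).sub (h₁.measurable ht)) hx.le
    rw [abs_neg, abs_mul]
    calc _ ≤ velocityConst γ p * K * (1 + x) ^ (1 - γ + p) * (M * (1 + x) ^ (q - 1)) :=
          mul_le_mul hvel (hM t ht hx.le) (abs_nonneg _) (by positivity)
      _ = velocityConst γ p * M * K * (1 + x) ^ (1 - γ + p + (q - 1)) := by
          rw [Real.rpow_add hx1 (1 - γ + p)]
          ring
      _ ≤ velocityConst γ p * M * K * (1 + x) ^ p := by gcongr <;> linarith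
  have hnonneg : ∀ x, 0 ≤ x → ω₂ t x = ω₁ t x := by
    intro x hx
    have hzero := (h₁.isTransport_sub hq.le hqγ hγ1 h₂).weightedBound_of_source_le (N₀ := 0) one_pos
      hqp hp.le hgrowth (fun s hs x hx => abs_velocity_le_linear hγ1 hq.le hqγ one_pos (hN₂ s hs)
        (h₂.measurable hs) hx.le) hsource (fun x _ => by simp [h₁.initial, h₂.initial])
      (lt_add_one _) t ht hx
    exact sub_eq_zero.1 (abs_nonpos_iff.1 (by simpa using hzero))
  rcases le_total 0 x with hx | hx
  · exact hnonneg x hx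
  · simpa only [h₁.odd t ht, h₂.odd t ht, neg_inj] using hnonneg (-x) (neg_nonneg.2 hx)

end IsSolution

/-! ### Riesz potentials of functions with algebraic decay -/

section rieszMajorant

variable {γ q : ℝ}

/-- An integrable majorant for products of `|·|^{-γ}` and `(1 + |·|)^{q - 1}`, with the
singularity of the first factor near `0` and the decay of the product at infinity. -/
def rieszMajorant (γ q z : ℝ) : ℝ :=
  (Icc (-1) 1).indicator (fun z : ℝ => |z| ^ (-γ)) z + 4 * (1 + ‖z‖) ^ (-(1 + γ - q))

theorem integrable_rieszMajorant (hqγ : q < γ) (hγ1 : γ < 1) :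
    Integrable (rieszMajorant γ q) := by
  refine Integrable.add ?_ ((integrable_one_add_norm (by simpa using by linarith)).const_mul 4)
  rw [integrable_indicator_iff measurableSet_Icc, integrableOn_Icc_iff_integrableOn_Ioc,
    ← intervalIntegrable_iff_integrableOn_Ioc_of_le (by norm_num)]
  exact intervalIntegrable_abs_rpow_neg hγ1 _ _

theorem abs_rpow_neg_le_rieszMajorant {z : ℝ} (hz : |z| ≤ 1) :
    |z| ^ (-γ) ≤ rieszMajorant γ q z := by
  rw [rieszMajorant, indicator_of_mem (show z ∈ Icc (-1) 1 from abs_le.1 hz)]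
  exact le_add_of_nonneg_right (by positivity)

theorem tail_le_rieszMajorant (γ q z : ℝ) :
    4 * (1 + |z|) ^ (-(1 + γ - q)) ≤ rieszMajorant γ q z :=
  le_add_of_nonneg_left (indicator_nonneg (fun _ _ => by positivity) z)

theorem rieszMajorant_nonneg (γ q z : ℝ) : 0 ≤ rieszMajorant γ q z :=
  le_trans (by positivity) (tail_le_rieszMajorant γ q z)

theorem rpow_mul_rpow_le_add_rpow {a b r s : ℝ} (ha : 0 < a) (hb : 0 < b) (hr : r ≤ 0)
    (hs : s ≤ 0) : a ^ r * b ^ s ≤ a ^ (r + s) + b ^ (r + s) := by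
  rw [Real.rpow_add ha, Real.rpow_add hb]
  rcases le_total a b with hab | hba
  · have hle := Real.rpow_le_rpow_of_nonpos ha hab hs
    exact le_add_of_le_of_nonneg (by gcongr) (by positivity)
  · have hle := Real.rpow_le_rpow_of_nonpos hb hba hr
    exact le_add_of_nonneg_of_le (by positivity) (by gcongr)

theorem rpow_neg_le_four_mul_one_add_rpow_neg {a s : ℝ} (ha : 1 ≤ a) (hs0 : 0 ≤ s) (hs : s ≤ 2) :
    a ^ (-s) ≤ 4 * (1 + a) ^ (-s) := by
  have ha0 : 0 < a := by linarith
  rw [Real.rpow_neg ha0.le, Real.rpow_neg (by linarith), ← div_eq_mul_inv,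
    le_div_iff₀ (by positivity), inv_mul_le_iff₀ (by positivity)]
  calc (1 + a) ^ s ≤ (2 * a) ^ s := by gcongr; linarith
    _ = 2 ^ s * a ^ s := Real.mul_rpow zero_le_two ha0.le
    _ ≤ 2 ^ (2 : ℝ) * a ^ s := by gcongr; exact one_le_two
    _ = a ^ s * 4 := by norm_num [mul_comm]

theorem abs_sub_rpow_mul_le_rieszMajorant (hq : 0 ≤ q) (hqγ : q < γ) (hγ1 : γ < 1) (x y : ℝ) :
    |x - y| ^ (-γ) * (1 + |y|) ^ (q - 1) ≤ rieszMajorant γ q (x - y) + rieszMajorant γ q y := by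
  have hy : 1 ≤ 1 + |y| := le_add_of_nonneg_right (abs_nonneg y)
  rcases le_total |x - y| 1 with hnear | hfar
  · calc |x - y| ^ (-γ) * (1 + |y|) ^ (q - 1) ≤ |x - y| ^ (-γ) :=
          mul_le_of_le_one_right (by positivity)
            (Real.rpow_le_one_of_one_le_of_nonpos hy (by linarith))
      _ ≤ rieszMajorant γ q (x - y) := abs_rpow_neg_le_rieszMajorant hnear
      _ ≤ _ := le_add_of_nonneg_right (rieszMajorant_nonneg γ q y)
  · calc |x - y| ^ (-γ) * (1 + |y|) ^ (q - 1)
        ≤ |x - y| ^ (-γ + (q - 1)) + (1 + |y|) ^ (-γ + (q - 1)) :=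
          rpow_mul_rpow_le_add_rpow (by linarith) (by linarith) (by linarith) (by linarith)
      _ = |x - y| ^ (-(1 + γ - q)) + (1 + |y|) ^ (-(1 + γ - q)) := by
          rw [show -γ + (q - 1) = -(1 + γ - q) by ring]
      _ ≤ 4 * (1 + |x - y|) ^ (-(1 + γ - q)) + 4 * (1 + |y|) ^ (-(1 + γ - q)) :=
          add_le_add (rpow_neg_le_four_mul_one_add_rpow_neg hfar (by linarith) (by linarith))
            (le_mul_of_one_le_left (by positivity) (by norm_num))
      _ ≤ _ := add_le_add (tail_le_rieszMajorant _ _ _) (tail_le_rieszMajorant _ _ _)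

theorem integrable_abs_sub_rpow_mul (hq : 0 ≤ q) (hqγ : q < γ) (hγ1 : γ < 1) (x : ℝ) :
    Integrable fun y : ℝ => |x - y| ^ (-γ) * (1 + |y|) ^ (q - 1) := by
  have hmajorant := integrable_rieszMajorant hqγ hγ1
  refine ((hmajorant.comp_sub_left x).add hmajorant).mono'
    (Measurable.aestronglyMeasurable (by fun_prop)) (ae_of_all _ fun y => ?_)
  rw [Real.norm_of_nonneg (by positivity)]
  exact abs_sub_rpow_mul_le_rieszMajorant hq hqγ hγ1 x y

/-- A uniform bound for the Riesz potential of `(1 + |·|)^{q - 1}`. -/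
def rieszConst (γ q : ℝ) : ℝ := 2 * ∫ z, rieszMajorant γ q z

theorem rieszConst_nonneg (γ q : ℝ) : 0 ≤ rieszConst γ q :=
  mul_nonneg zero_le_two (integral_nonneg (rieszMajorant_nonneg γ q))

theorem integral_abs_sub_rpow_mul_le (hq : 0 ≤ q) (hqγ : q < γ) (hγ1 : γ < 1) (x : ℝ) :
    ∫ y : ℝ, |x - y| ^ (-γ) * (1 + |y|) ^ (q - 1) ≤ rieszConst γ q := by
  have hmajorant := integrable_rieszMajorant hqγ hγ1
  calc ∫ y : ℝ, |x - y| ^ (-γ) * (1 + |y|) ^ (q - 1)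
      ≤ ∫ y, (rieszMajorant γ q (x - y) + rieszMajorant γ q y) :=
        integral_mono (integrable_abs_sub_rpow_mul hq hqγ hγ1 x)
          ((hmajorant.comp_sub_left x).add hmajorant)
          (abs_sub_rpow_mul_le_rieszMajorant hq hqγ hγ1 x)
    _ = rieszConst γ q := by
        rw [integral_add (hmajorant.comp_sub_left x) hmajorant, integral_sub_left_eq_self,
          rieszConst, two_mul]

theorem one_add_abs_add_rpow_le {s : ℝ} (hs : s ≤ 0) (x z : ℝ) :
    (1 + |x + z|) ^ s ≤ (1 + |x|) ^ (-s) * (1 + |z|) ^ s := by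
  have htriangle : |z| ≤ |x + z| + |x| := by simpa using abs_sub (x + z) x
  have hprod : 1 + |z| ≤ (1 + |x|) * (1 + |x + z|) := by
    nlinarith [mul_nonneg (abs_nonneg x) (abs_nonneg (x + z))]
  rw [Real.rpow_neg (by positivity), ← div_eq_inv_mul, le_div_iff₀ (by positivity),
    ← Real.mul_rpow (by positivity) (by positivity), mul_comm]
  exact Real.rpow_le_rpow_of_nonpos (by positivity) hprod hs

end rieszMajorant

/-! ### Odd flow maps -/

section flowMap

variable {v : ℝ →ᵇ ℝ}

/-- The odd map with derivative `1 + v |x|`; it parametrizes odd flow maps by their gradients. -/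
def flowMap (v : ℝ →ᵇ ℝ) (x : ℝ) : ℝ := x + ∫ s in (0 : ℝ)..x, v |s|

theorem continuous_comp_abs (v : ℝ →ᵇ ℝ) : Continuous fun s : ℝ => v |s| :=
  v.continuous.comp continuous_abs

theorem flowMap_sub (v : ℝ →ᵇ ℝ) (x y : ℝ) :
    flowMap v x - flowMap v y = x - y + ∫ s in y..x, v |s| := by
  rw [flowMap, flowMap, ← intervalIntegral.integral_interval_sub_left
    ((continuous_comp_abs v).intervalIntegrable 0 x)
    ((continuous_comp_abs v).intervalIntegrable 0 y)]
  ring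

theorem abs_integral_comp_abs_le (v : ℝ →ᵇ ℝ) (x y : ℝ) :
    |(∫ s in y..x, v |s|)| ≤ ‖v‖ * |x - y| :=
  intervalIntegral.norm_integral_le_of_norm_le_const fun s _ => v.norm_coe_le_norm |s|

theorem half_abs_sub_le_abs_flowMap_sub (hv : ‖v‖ ≤ 1 / 2) (x y : ℝ) :
    |x - y| / 2 ≤ |flowMap v x - flowMap v y| := by
  have hint := abs_integral_comp_abs_le v x y
  have htriangle := abs_sub_abs_le_abs_sub (x - y) (-∫ s in y..x, v |s|)
  rw [abs_neg, sub_neg_eq_add, ← flowMap_sub] at htriangle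
  nlinarith [abs_nonneg (x - y)]

theorem abs_flowMap_sub_sub_le (v w : ℝ →ᵇ ℝ) (x y : ℝ) :
    |flowMap v x - flowMap v y - (flowMap w x - flowMap w y)| ≤ ‖v - w‖ * |x - y| := by
  rw [flowMap_sub, flowMap_sub, add_sub_add_left_eq_sub, ← intervalIntegral.integral_sub
    ((continuous_comp_abs v).intervalIntegrable _ _)
    ((continuous_comp_abs w).intervalIntegrable _ _)]
  exact abs_integral_comp_abs_le (v - w) x y

theorem flowMap_neg (v : ℝ →ᵇ ℝ) (x : ℝ) : flowMap v (-x) = -flowMap v x := by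
  have h := intervalIntegral.integral_comp_neg (a := 0) (b := x) (fun s : ℝ => v |s|)
  simp only [abs_neg, neg_zero] at h
  rw [flowMap, flowMap, h, intervalIntegral.integral_symm, neg_add]

theorem flowMap_apply_zero (v : ℝ →ᵇ ℝ) : flowMap v 0 = 0 := by
  rw [flowMap, intervalIntegral.integral_same, add_zero]

theorem hasDerivAt_flowMap (v : ℝ →ᵇ ℝ) (x : ℝ) : HasDerivAt (flowMap v) (1 + v |x|) x :=
  (hasDerivAt_id x).add ((continuous_comp_abs v).integral_hasStrictDerivAt 0 x).hasDerivAt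

theorem continuous_flowMap (v : ℝ →ᵇ ℝ) : Continuous (flowMap v) :=
  continuous_iff_continuousAt.2 fun x => (hasDerivAt_flowMap v x).continuousAt

theorem half_le_one_add (hv : ‖v‖ ≤ 1 / 2) (x : ℝ) : 1 / 2 ≤ 1 + v x := by
  linarith [(abs_le.1 ((v.norm_coe_le_norm x).trans hv)).1]

theorem flowMap_injective (hv : ‖v‖ ≤ 1 / 2) : Function.Injective (flowMap v) := fun x y hxy => by
  have h := half_abs_sub_le_abs_flowMap_sub hv x y
  rw [hxy, sub_self, abs_zero] at h
  exact sub_eq_zero.1 (abs_nonpos_iff.1 (by linarith))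

theorem half_le_flowMap (hv : ‖v‖ ≤ 1 / 2) {x : ℝ} (hx : 0 ≤ x) : x / 2 ≤ flowMap v x := by
  have h := (abs_le.1 (abs_integral_comp_abs_le v x 0)).1
  rw [sub_zero, abs_of_nonneg hx] at h
  rw [flowMap]
  nlinarith

theorem flowMap_surjective (hv : ‖v‖ ≤ 1 / 2) : Function.Surjective (flowMap v) := by
  have hbot : ∀ x ≤ 0, flowMap v x ≤ x / 2 := fun x hx => by
    have h := half_le_flowMap hv (neg_nonneg.2 hx)
    rw [flowMap_neg] at h
    linarith
  exact (continuous_flowMap v).surjective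
    (tendsto_atTop_mono' _ ((eventually_ge_atTop 0).mono fun x => half_le_flowMap hv)
      (tendsto_id.atTop_div_const two_pos))
    (tendsto_atBot_mono' _ ((eventually_le_atBot 0).mono hbot)
      (tendsto_id.atBot_div_const two_pos))

end flowMap

/-! ### The velocity gradient in Lagrangian coordinates -/

/-- The velocity gradient `-∫ |X(x) - X(y)|^{-γ} g(y) dy` at the point `X(x)`, where `X` is the
flow map with gradient `1 + v |·|` and `g = ω₀'`. No Jacobian appears, since
`ω_x(t, X(y)) X'(y) = g(y)`. -/
def strain (γ : ℝ) (g : ℝ → ℝ) (v : ℝ →ᵇ ℝ) (x : ℝ) : ℝ :=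
  -∫ y, |flowMap v x - flowMap v y| ^ (-γ) * g y

section strain

variable {γ q M : ℝ} {g : ℝ → ℝ} {v w : ℝ →ᵇ ℝ}

theorem strain_neg (hg : Function.Even g) (v : ℝ →ᵇ ℝ) (x : ℝ) :
    strain γ g v (-x) = strain γ g v x := by
  rw [strain, strain, ← integral_neg_eq_self]
  simp only [flowMap_neg, hg _, neg_sub_neg, abs_sub_comm]

theorem strain_abs (hg : Function.Even g) (v : ℝ →ᵇ ℝ) (x : ℝ) :
    strain γ g v |x| = strain γ g v x := by
  rcases abs_choice x with h | h <;> rw [h]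
  exact strain_neg hg v x

theorem abs_flowMap_sub_rpow_neg_le (hγ : 0 < γ) (hγ1 : γ ≤ 1) (hv : ‖v‖ ≤ 1 / 2) (x y : ℝ) :
    |flowMap v x - flowMap v y| ^ (-γ) ≤ 2 * |x - y| ^ (-γ) := by
  rcases eq_or_ne x y with rfl | hxy
  · simp [Real.zero_rpow (neg_ne_zero.2 hγ.ne')]
  have h0 : 0 < |x - y| := abs_pos.2 (sub_ne_zero.2 hxy)
  calc |flowMap v x - flowMap v y| ^ (-γ) ≤ (|x - y| / 2) ^ (-γ) :=
        Real.rpow_le_rpow_of_nonpos (by positivity) (half_abs_sub_le_abs_flowMap_sub hv x y)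
          (by linarith)
    _ = 2 ^ γ * |x - y| ^ (-γ) := by
        rw [Real.div_rpow h0.le zero_le_two, div_eq_mul_inv, ← Real.rpow_neg zero_le_two,
          neg_neg, mul_comm]
    _ ≤ 2 ^ (1 : ℝ) * |x - y| ^ (-γ) := by gcongr; exact one_le_two
    _ = _ := by rw [Real.rpow_one]

theorem abs_flowMap_sub_rpow_neg_sub_le (hγ : 0 < γ) (hγ1 : γ ≤ 1) (hv : ‖v‖ ≤ 1 / 2)
    (hw : ‖w‖ ≤ 1 / 2) (x y : ℝ) :
    |(|flowMap v x - flowMap v y| ^ (-γ) - |flowMap w x - flowMap w y| ^ (-γ))| ≤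
      4 * ‖v - w‖ * |x - y| ^ (-γ) := by
  rcases eq_or_ne x y with rfl | hxy
  · simp [Real.zero_rpow (neg_ne_zero.2 hγ.ne')]
  have h0 : 0 < |x - y| := abs_pos.2 (sub_ne_zero.2 hxy)
  have hdiff := (abs_abs_sub_abs_le _ _).trans (abs_flowMap_sub_sub_le v w x y)
  have hscale : (|x - y| / 2) ^ (-γ - 1) * |x - y| = 2 ^ (γ + 1) * |x - y| ^ (-γ) := by
    rw [Real.div_rpow h0.le zero_le_two, div_eq_mul_inv, ← Real.rpow_neg zero_le_two,
      Real.rpow_sub_one h0.ne', show -(-γ - 1) = γ + 1 by ring]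
    field_simp
  have hfour : (2 : ℝ) ^ (γ + 1) ≤ 4 := by
    calc (2 : ℝ) ^ (γ + 1) ≤ 2 ^ (2 : ℝ) :=
          Real.rpow_le_rpow_of_exponent_le one_le_two (by linarith)
      _ = 4 := by norm_num
  calc _ ≤ γ * (|x - y| / 2) ^ (-γ - 1) * (‖v - w‖ * |x - y|) :=
        (abs_rpow_neg_sub_rpow_neg_le hγ.le (half_pos h0) (half_abs_sub_le_abs_flowMap_sub hv x y)
          (half_abs_sub_le_abs_flowMap_sub hw x y)).trans (by gcongr)
    _ = γ * ‖v - w‖ * ((|x - y| / 2) ^ (-γ - 1) * |x - y|) := by ring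
    _ = γ * ‖v - w‖ * (2 ^ (γ + 1) * |x - y| ^ (-γ)) := by rw [hscale]
    _ ≤ 1 * ‖v - w‖ * (4 * |x - y| ^ (-γ)) := by gcongr
    _ = _ := by ring

theorem nonneg_of_forall_abs_le_mul_rpow {s : ℝ} (hg : ∀ y, |g y| ≤ M * (1 + |y|) ^ s) : 0 ≤ M :=
  nonneg_of_mul_nonneg_left ((abs_nonneg _).trans (hg 0)) (by positivity)

theorem norm_strain_integrand_le (hγ : 0 < γ) (hγ1 : γ ≤ 1)
    (hgM : ∀ y, |g y| ≤ M * (1 + |y|) ^ (q - 1)) (hv : ‖v‖ ≤ 1 / 2) (x y : ℝ) :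
    ‖|flowMap v x - flowMap v y| ^ (-γ) * g y‖ ≤
      2 * M * (|x - y| ^ (-γ) * (1 + |y|) ^ (q - 1)) := by
  rw [norm_mul, Real.norm_of_nonneg (by positivity), Real.norm_eq_abs]
  calc _ ≤ (2 * |x - y| ^ (-γ)) * (M * (1 + |y|) ^ (q - 1)) :=
        mul_le_mul (abs_flowMap_sub_rpow_neg_le hγ hγ1 hv x y) (hgM y) (abs_nonneg _)
          (by positivity)
    _ = _ := by ring

theorem integrable_strain_integrand (hq : 0 ≤ q) (hqγ : q < γ) (hγ1 : γ < 1) (hgm : Measurable g)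
    (hgM : ∀ y, |g y| ≤ M * (1 + |y|) ^ (q - 1)) (hv : ‖v‖ ≤ 1 / 2) (x : ℝ) :
    Integrable fun y => |flowMap v x - flowMap v y| ^ (-γ) * g y := by
  have hflow := (continuous_flowMap v).measurable
  exact ((integrable_abs_sub_rpow_mul hq hqγ hγ1 x).const_mul (2 * M)).mono'
    (Measurable.aestronglyMeasurable (by fun_prop))
    (ae_of_all _ fun y => norm_strain_integrand_le (hq.trans_lt hqγ) hγ1.le hgM hv x y)

theorem abs_strain_le (hq : 0 ≤ q) (hqγ : q < γ) (hγ1 : γ < 1)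
    (hgM : ∀ y, |g y| ≤ M * (1 + |y|) ^ (q - 1)) (hv : ‖v‖ ≤ 1 / 2) (x : ℝ) :
    |strain γ g v x| ≤ 2 * M * rieszConst γ q := by
  have hM := nonneg_of_forall_abs_le_mul_rpow hgM
  rw [strain, abs_neg]
  calc _ ≤ ∫ y, 2 * M * (|x - y| ^ (-γ) * (1 + |y|) ^ (q - 1)) :=
        norm_integral_le_of_norm_le ((integrable_abs_sub_rpow_mul hq hqγ hγ1 x).const_mul _)
          (ae_of_all _ fun y => norm_strain_integrand_le (hq.trans_lt hqγ) hγ1.le hgM hv x y)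
    _ ≤ _ := by
        rw [integral_const_mul]
        gcongr
        exact integral_abs_sub_rpow_mul_le hq hqγ hγ1 x

theorem abs_strain_sub_le (hq : 0 ≤ q) (hqγ : q < γ) (hγ1 : γ < 1) (hgm : Measurable g)
    (hgM : ∀ y, |g y| ≤ M * (1 + |y|) ^ (q - 1)) (hv : ‖v‖ ≤ 1 / 2) (hw : ‖w‖ ≤ 1 / 2) (x : ℝ) :
    |strain γ g v x - strain γ g w x| ≤ 4 * M * rieszConst γ q * ‖v - w‖ := by
  have hM := nonneg_of_forall_abs_le_mul_rpow hgM
  have hpointwise : ∀ y, ‖|flowMap v x - flowMap v y| ^ (-γ) * g y -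
      |flowMap w x - flowMap w y| ^ (-γ) * g y‖ ≤
        4 * M * ‖v - w‖ * (|x - y| ^ (-γ) * (1 + |y|) ^ (q - 1)) := by
    intro y
    rw [← sub_mul, norm_mul, Real.norm_eq_abs, Real.norm_eq_abs]
    calc _ ≤ (4 * ‖v - w‖ * |x - y| ^ (-γ)) * (M * (1 + |y|) ^ (q - 1)) :=
          mul_le_mul (abs_flowMap_sub_rpow_neg_sub_le (hq.trans_lt hqγ) hγ1.le hv hw x y) (hgM y)
            (abs_nonneg _) (by positivity)
      _ = _ := by ring
  rw [strain, strain, neg_sub_neg, abs_sub_comm, ← integral_sub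
    (integrable_strain_integrand hq hqγ hγ1 hgm hgM hv x)
    (integrable_strain_integrand hq hqγ hγ1 hgm hgM hw x)]
  calc _ ≤ ∫ y, 4 * M * ‖v - w‖ * (|x - y| ^ (-γ) * (1 + |y|) ^ (q - 1)) :=
        norm_integral_le_of_norm_le ((integrable_abs_sub_rpow_mul hq hqγ hγ1 x).const_mul _)
          (ae_of_all _ hpointwise)
    _ ≤ 4 * M * ‖v - w‖ * rieszConst γ q := by
        rw [integral_const_mul]
        gcongr
        exact integral_abs_sub_rpow_mul_le hq hqγ hγ1 x
    _ = _ := by ring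

/-- After the substitution `y = x + z` the singularity no longer moves with `x`. -/
theorem continuous_strain (hq : 0 ≤ q) (hqγ : q < γ) (hγ1 : γ < 1) (hgc : Continuous g)
    (hgM : ∀ y, |g y| ≤ M * (1 + |y|) ^ (q - 1)) (hv : ‖v‖ ≤ 1 / 2) :
    Continuous (strain γ g v) := by
  have hM := nonneg_of_forall_abs_le_mul_rpow hgM
  have hflow := continuous_flowMap v
  have hflowm := hflow.measurable
  have hgm := hgc.measurable
  have htranslate : strain γ g v =
      fun x => -∫ z, |flowMap v x - flowMap v (x + z)| ^ (-γ) * g (x + z) := by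
    funext x
    rw [strain, ← integral_add_left_eq_self _ x]
  rw [htranslate, continuous_iff_continuousAt]
  refine fun x₀ => (continuousAt_of_dominated (bound := fun z =>
    2 * M * (2 + |x₀|) ^ (1 - q) * (|0 - z| ^ (-γ) * (1 + |z|) ^ (q - 1))) ?_ ?_ ?_ ?_).neg
  · exact Eventually.of_forall fun x => Measurable.aestronglyMeasurable (by fun_prop)
  · filter_upwards [Metric.ball_mem_nhds x₀ one_pos] with x hx
    refine ae_of_all _ fun z => ?_
    have hxx₀ : 1 + |x| ≤ 2 + |x₀| := by
      rw [Metric.mem_ball, Real.dist_eq] at hx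
      linarith [abs_sub_abs_le_abs_sub x x₀]
    have hshift : (1 + |x + z|) ^ (q - 1) ≤ (2 + |x₀|) ^ (1 - q) * (1 + |z|) ^ (q - 1) := by
      refine (one_add_abs_add_rpow_le (by linarith) x z).trans ?_
      rw [neg_sub]
      gcongr
      linarith
    calc _ ≤ 2 * M * (|x - (x + z)| ^ (-γ) * (1 + |x + z|) ^ (q - 1)) :=
          norm_strain_integrand_le (hq.trans_lt hqγ) hγ1.le hgM hv x (x + z)
      _ ≤ 2 * M * (|0 - z| ^ (-γ) * ((2 + |x₀|) ^ (1 - q) * (1 + |z|) ^ (q - 1))) := by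
          rw [sub_add_cancel_left, zero_sub]
          gcongr
      _ = _ := by ring
  · exact (integrable_abs_sub_rpow_mul hq hqγ hγ1 0).const_mul _
  · filter_upwards [Measure.ae_ne volume (0 : ℝ)] with z hz
    refine ContinuousAt.mul (ContinuousAt.rpow_const (by fun_prop) (Or.inl ?_)) (by fun_prop)
    exact abs_ne_zero.2 (sub_ne_zero.2 fun h => hz (left_eq_add.1 (flowMap_injective hv h)))

end strain

section ode

variable {E : Type*} [NormedAddCommGroup E] [NormedSpace ℝ E]

theorem exists_hasDerivAt_of_lipschitzOnWith [CompleteSpace E] {f : E → E} {x₀ : E} {s : Set E}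
    {K : NNReal} (hs : s ∈ 𝓝 x₀) (hf : LipschitzOnWith K f s) :
    ∃ T : ℝ, 0 < T ∧ ∃ v : ℝ → E, v 0 = x₀ ∧
      ∀ t ∈ Ioo (-T) T, v t ∈ s ∧ HasDerivAt v (f (v t)) t := by
  obtain ⟨r, hr, hrs⟩ := Metric.nhds_basis_closedBall.mem_iff.1 hs
  lift r to NNReal using hr.le
  set L : NNReal := K * r + ‖f x₀‖₊
  have hbound : ∀ x ∈ Metric.closedBall x₀ (r : ℝ), ‖f x‖ ≤ L := by
    intro x hx
    have hdist : ‖x - x₀‖ ≤ r := mem_closedBall_iff_norm.1 hx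
    calc ‖f x‖ ≤ ‖f x - f x₀‖ + ‖f x₀‖ := norm_le_norm_sub_add _ _
      _ ≤ K * r + ‖f x₀‖ := by
        gcongr
        exact (hf.norm_sub_le (hrs hx) (mem_of_mem_nhds hs)).trans (by gcongr)
  set ε : ℝ := r / (L + 1) with hε
  have hε0 : 0 < ε := by positivity
  have hLε : L * ε ≤ r := by
    rw [hε, mul_div_assoc', div_le_iff₀ (by positivity), mul_comm]
    gcongr
    exact le_add_of_nonneg_right zero_le_one
  have hPL : IsPicardLindelof (fun _ : ℝ => f) (tmin := -ε) (tmax := ε)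
      ⟨0, by constructor <;> linarith⟩ x₀ r 0 L K :=
    .of_time_independent hbound (hf.mono hrs) (by simpa using hLε)
  obtain ⟨v, hv0, hv⟩ := hPL.exists_eq_forall_mem_Icc_hasDerivWithinAt₀
  simp only at hv0
  have hderiv : ∀ t ∈ Ioo (-ε) ε, HasDerivAt v (f (v t)) t := fun t ht =>
    (hv t (Ioo_subset_Icc_self ht)).hasDerivAt (Icc_mem_nhds ht.1 ht.2)
  have hmem : v ⁻¹' s ∈ 𝓝 (0 : ℝ) :=
    (hderiv 0 ⟨by linarith, hε0⟩).continuousAt.preimage_mem_nhds (hv0 ▸ hs)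
  obtain ⟨δ, hδ, hδs⟩ := Metric.mem_nhds_iff.1 hmem
  rw [Real.ball_zero_eq_Ioo] at hδs
  refine ⟨min δ ε, lt_min hδ hε0, v, hv0, fun t ht => ⟨hδs ?_, hderiv t ?_⟩⟩
  · exact Ioo_subset_Ioo (neg_le_neg (min_le_left _ _)) (min_le_left _ _) ht
  · exact Ioo_subset_Ioo (neg_le_neg (min_le_right _ _)) (min_le_right _ _) ht

theorem contDiffOn_one_of_hasDerivAt {v v' : ℝ → E} {s : Set ℝ} (hs : IsOpen s)
    (hv : ∀ t ∈ s, HasDerivAt v (v' t) t) (hv' : ContinuousOn v' s) : ContDiffOn ℝ 1 v s := by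
  rw [← zero_add (1 : WithTop ℕ∞), contDiffOn_succ_iff_deriv_of_isOpen hs]
  refine ⟨fun t ht => (hv t ht).differentiableAt.differentiableWithinAt, by simp, ?_⟩
  exact contDiffOn_zero.2 (hv'.congr fun t ht => (hv t ht).deriv)

end ode

section lagrangianField

open Classical in
/-- The vector field `v ↦ (1 + v) * strain v` on bounded continuous functions: the Lagrangian
formulation of the patch equation is the ordinary differential equation `v' = lagrangianField γ g v`
for the displacement gradient. The value is `0` where the formula does not define a bounded
continuous function; this does not happen on the ball `‖v‖ ≤ 1 / 2`. -/
def lagrangianField (γ : ℝ) (g : ℝ → ℝ) (v : ℝ →ᵇ ℝ) : ℝ →ᵇ ℝ :=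
  if h : Continuous (fun x => (1 + v x) * strain γ g v x) ∧
      ∃ C, ∀ x, ‖(1 + v x) * strain γ g v x‖ ≤ C then
    .ofNormedAddCommGroup _ h.1 h.2.choose h.2.choose_spec
  else 0

variable {γ q M : ℝ} {g : ℝ → ℝ} {v w : ℝ →ᵇ ℝ}

theorem abs_one_add_le (hv : ‖v‖ ≤ 1 / 2) (x : ℝ) : |1 + v x| ≤ 3 / 2 := by
  have h := (v.norm_coe_le_norm x).trans hv
  rw [Real.norm_eq_abs] at h
  linarith [abs_add_le 1 (v x), abs_one (α := ℝ)]

theorem lagrangianField_apply (hq : 0 ≤ q) (hqγ : q < γ) (hγ1 : γ < 1) (hgc : Continuous g)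
    (hgM : ∀ y, |g y| ≤ M * (1 + |y|) ^ (q - 1)) (hv : ‖v‖ ≤ 1 / 2) (x : ℝ) :
    lagrangianField γ g v x = (1 + v x) * strain γ g v x := by
  have hcont := continuous_strain hq hqγ hγ1 hgc hgM hv
  have hbound : ∀ x, ‖(1 + v x) * strain γ g v x‖ ≤ 3 / 2 * (2 * M * rieszConst γ q) := by
    intro x
    rw [norm_mul]
    exact mul_le_mul (abs_one_add_le hv x) (abs_strain_le hq hqγ hγ1 hgM hv x) (abs_nonneg _)
      (by norm_num)
  rw [lagrangianField, dif_pos ⟨by fun_prop, _, hbound⟩]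
  rfl

theorem norm_lagrangianField_sub_le (hq : 0 ≤ q) (hqγ : q < γ) (hγ1 : γ < 1)
    (hgc : Continuous g) (hgM : ∀ y, |g y| ≤ M * (1 + |y|) ^ (q - 1)) (hv : ‖v‖ ≤ 1 / 2)
    (hw : ‖w‖ ≤ 1 / 2) :
    ‖lagrangianField γ g v - lagrangianField γ g w‖ ≤ 8 * M * rieszConst γ q * ‖v - w‖ := by
  have hM := nonneg_of_forall_abs_le_mul_rpow hgM
  have hA := rieszConst_nonneg γ q
  refine (BoundedContinuousFunction.norm_le (by positivity)).2 fun x => ?_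
  rw [BoundedContinuousFunction.sub_apply, lagrangianField_apply hq hqγ hγ1 hgc hgM hv,
    lagrangianField_apply hq hqγ hγ1 hgc hgM hw]
  calc ‖(1 + v x) * strain γ g v x - (1 + w x) * strain γ g w x‖
      = |(v x - w x) * strain γ g v x + (1 + w x) * (strain γ g v x - strain γ g w x)| := by
        rw [Real.norm_eq_abs]; congr 1; ring
    _ ≤ |v x - w x| * |strain γ g v x| + |1 + w x| * |strain γ g v x - strain γ g w x| := by
        rw [← abs_mul, ← abs_mul]; exact abs_add_le _ _
    _ ≤ ‖v - w‖ * (2 * M * rieszConst γ q) +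
        3 / 2 * (4 * M * rieszConst γ q * ‖v - w‖) := by
        gcongr
        · exact (v - w).norm_coe_le_norm x
        · exact abs_strain_le hq hqγ hγ1 hgM hv x
        · exact abs_one_add_le hw x
        · exact abs_strain_sub_le hq hqγ hγ1 hgc.measurable hgM hv hw x
    _ = _ := by ring

theorem exists_lagrangian_solution (hq : 0 ≤ q) (hqγ : q < γ) (hγ1 : γ < 1) (hgc : Continuous g)
    (hgM : ∀ y, |g y| ≤ M * (1 + |y|) ^ (q - 1)) :
    ∃ T : ℝ, 0 < T ∧ ∃ v : ℝ → ℝ →ᵇ ℝ, v 0 = 0 ∧ (∀ t ∈ Ioo (-T) T, ‖v t‖ < 1 / 2) ∧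
      ContDiffOn ℝ 1 v (Ioo (-T) T) ∧
      ∀ t ∈ Ioo (-T) T, HasDerivAt v (lagrangianField γ g (v t)) t := by
  have hM := nonneg_of_forall_abs_le_mul_rpow hgM
  have hA := rieszConst_nonneg γ q
  have hlip : LipschitzOnWith ⟨8 * M * rieszConst γ q, by positivity⟩ (lagrangianField γ g)
      (Metric.ball (0 : ℝ →ᵇ ℝ) (1 / 2)) := by
    refine LipschitzOnWith.of_dist_le_mul fun v hv w hw => ?_
    rw [dist_eq_norm, dist_eq_norm]
    exact norm_lagrangianField_sub_le hq hqγ hγ1 hgc hgM (mem_ball_zero_iff.1 hv).le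
      (mem_ball_zero_iff.1 hw).le
  obtain ⟨T, hT, v, hv0, hv⟩ :=
    exists_hasDerivAt_of_lipschitzOnWith (Metric.ball_mem_nhds 0 (by norm_num)) hlip
  refine ⟨T, hT, v, hv0, fun t ht => mem_ball_zero_iff.1 (hv t ht).1,
    contDiffOn_one_of_hasDerivAt isOpen_Ioo (fun t ht => (hv t ht).2) ?_, fun t ht => (hv t ht).2⟩
  exact hlip.continuousOn.comp (fun t ht => (hv t ht).2.continuousAt.continuousWithinAt)
    fun t ht => (hv t ht).1

end lagrangianField

section kernelAntideriv

variable {γ q N x : ℝ} {f : ℝ → ℝ}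

theorem continuous_kernelPrimitive (hγ : γ < 1) : Continuous (kernelPrimitive γ) :=
  intervalIntegral.continuous_primitive (intervalIntegrable_abs_rpow_neg hγ) 0

theorem hasDerivAt_kernelPrimitive {z : ℝ} (hγ : γ < 1) (hz : z ≠ 0) :
    HasDerivAt (kernelPrimitive γ) (|z| ^ (-γ)) z := by
  refine intervalIntegral.integral_hasDerivAt_right (intervalIntegrable_abs_rpow_neg hγ 0 z) ?_ ?_
  · exact Measurable.stronglyMeasurable (by fun_prop) |>.stronglyMeasurableAtFilter
  · exact continuous_abs.continuousAt.rpow_const (Or.inl (abs_ne_zero.2 hz))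

/-- An antiderivative of `-kernel γ x`, the one that vanishes at infinity for `0 < γ`. -/
def kernelAntideriv (γ x y : ℝ) : ℝ := kernelPrimitive γ (x - y) + kernelPrimitive γ (x + y)

theorem continuous_kernelAntideriv (hγ : γ < 1) (x : ℝ) : Continuous (kernelAntideriv γ x) := by
  have hprim := continuous_kernelPrimitive hγ
  unfold kernelAntideriv
  fun_prop

theorem hasDerivAt_kernelAntideriv {y : ℝ} (hγ : γ < 1) (hsub : x ≠ y) (hadd : x + y ≠ 0) :
    HasDerivAt (kernelAntideriv γ x) (-kernel γ x y) y := by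
  have hleft := (hasDerivAt_kernelPrimitive hγ (sub_ne_zero.2 hsub)).comp y
    ((hasDerivAt_id y).const_sub x)
  have hright := (hasDerivAt_kernelPrimitive hγ hadd).comp y ((hasDerivAt_id y).const_add x)
  refine (hleft.add hright).congr_deriv ?_
  rw [kernel_eq, abs_sub_comm y x]
  ring

theorem abs_kernelAntideriv_le {R : ℝ} (hγ : 0 ≤ γ) (hγ1 : γ < 1) (hx : 0 ≤ x) (hR : 0 < R)
    (hxR : 2 * x ≤ R) : |kernelAntideriv γ x R| ≤ 2 * x * (R / 2) ^ (-γ) := by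
  have hintegral : kernelAntideriv γ x R = ∫ s in (R - x)..(R + x), |s| ^ (-γ) := by
    have h := integral_abs_sub_rpow_neg hγ1 0 (R - x) (R + x)
    simp only [sub_zero] at h
    rw [h, kernelAntideriv, ← neg_sub R x, kernelPrimitive_neg, add_comm x R, neg_add_eq_sub]
  have hbound : ∀ s ∈ uIoc (R - x) (R + x), ‖|s| ^ (-γ)‖ ≤ (R / 2) ^ (-γ) := by
    intro s hs
    rw [uIoc_of_le (by linarith)] at hs
    rw [Real.norm_of_nonneg (by positivity)]
    exact Real.rpow_le_rpow_of_nonpos (half_pos hR) (by linarith [hs.1, le_abs_self s])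
      (neg_nonpos.2 hγ)
  rw [hintegral]
  refine (intervalIntegral.norm_integral_le_of_norm_le_const hbound).trans_eq ?_
  rw [show R + x - (R - x) = 2 * x by ring, abs_of_nonneg (by linarith), mul_comm]

theorem tendsto_mul_kernelAntideriv (hq : 0 ≤ q) (hqγ : q < γ) (hγ1 : γ < 1)
    (hf : WeightedBound 1 q N f) (hx : 0 ≤ x) :
    Tendsto (fun R => f R * kernelAntideriv γ x R) atTop (𝓝 0) := by
  have hN := hf.nonneg one_pos
  have hlim : Tendsto (fun R : ℝ => N * 2 ^ q * (2 * x * 2 ^ γ) * R ^ (-(γ - q))) atTop (𝓝 0) := by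
    simpa only [mul_zero] using (tendsto_rpow_neg_atTop (sub_pos.2 hqγ)).const_mul _
  refine squeeze_zero_norm' ?_ hlim
  filter_upwards [eventually_ge_atTop (2 * x), eventually_ge_atTop 1] with R hxR hR1
  have hR0 : 0 < R := by linarith
  have hfR : |f R| ≤ N * (2 ^ q * R ^ q) := by
    rw [← Real.mul_rpow zero_le_two hR0.le]
    refine (hf hR0.le).trans ?_
    gcongr
    linarith
  have hKR : |kernelAntideriv γ x R| ≤ 2 * x * (2 ^ γ * R ^ (-γ)) := by
    refine (abs_kernelAntideriv_le (hq.trans hqγ.le) hγ1 hx hR0 hxR).trans_eq ?_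
    rw [Real.div_rpow hR0.le zero_le_two, div_eq_mul_inv, ← Real.rpow_neg zero_le_two, neg_neg,
      mul_comm (R ^ (-γ))]
  calc ‖f R * kernelAntideriv γ x R‖
      ≤ (N * (2 ^ q * R ^ q)) * (2 * x * (2 ^ γ * R ^ (-γ))) := by
        rw [norm_mul]
        exact mul_le_mul hfR hKR (abs_nonneg _) (by positivity)
    _ = N * 2 ^ q * (2 * x * 2 ^ γ) * (R ^ q * R ^ (-γ)) := by ring
    _ = _ := by rw [← Real.rpow_add hR0, neg_sub, sub_eq_add_neg]

end kernelAntideriv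

/-! ### The velocity gradient as a Riesz potential -/

section rieszPotential

variable {γ q M N x : ℝ} {f g : ℝ → ℝ}

/-- The Riesz potential of order `1 - γ` on the line, without the normalizing constant. -/
def rieszPotential (γ : ℝ) (g : ℝ → ℝ) (x : ℝ) : ℝ := ∫ y, |x - y| ^ (-γ) * g y

theorem integral_eq_integral_Ioi_add_neg {G : ℝ → ℝ} (hG : Integrable G) :
    ∫ y, G y = ∫ y in Ioi 0, (G y + G (-y)) := by
  rw [integral_add hG.integrableOn hG.comp_neg.integrableOn, integral_comp_neg_Ioi, neg_zero,
    add_comm, intervalIntegral.integral_Iic_add_Ioi hG.integrableOn hG.integrableOn]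

theorem norm_abs_sub_rpow_mul_le (hgM : ∀ y, |g y| ≤ M * (1 + |y|) ^ (q - 1)) (x y : ℝ) :
    ‖|x - y| ^ (-γ) * g y‖ ≤ M * (|x - y| ^ (-γ) * (1 + |y|) ^ (q - 1)) := by
  rw [norm_mul, Real.norm_of_nonneg (by positivity), mul_left_comm]
  exact mul_le_mul_of_nonneg_left (hgM y) (by positivity)

theorem integrable_abs_sub_rpow_mul_of_le (hq : 0 ≤ q) (hqγ : q < γ) (hγ1 : γ < 1)
    (hgm : Measurable g) (hgM : ∀ y, |g y| ≤ M * (1 + |y|) ^ (q - 1)) (x : ℝ) :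
    Integrable fun y => |x - y| ^ (-γ) * g y :=
  ((integrable_abs_sub_rpow_mul hq hqγ hγ1 x).const_mul M).mono'
    (Measurable.aestronglyMeasurable (by fun_prop)) (ae_of_all _ (norm_abs_sub_rpow_mul_le hgM x))

theorem integrable_prod_abs_sub_rpow_mul (hq : 0 ≤ q) (hqγ : q < γ) (hγ1 : γ < 1)
    (hgm : Measurable g) (hgM : ∀ y, |g y| ≤ M * (1 + |y|) ^ (q - 1)) (x : ℝ) :
    Integrable (Function.uncurry fun s y : ℝ => |s - y| ^ (-γ) * g y)
      ((volume.restrict (Ioc 0 x)).prod volume) := by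
  have hM := nonneg_of_forall_abs_le_mul_rpow hgM
  have hmeas : Measurable (Function.uncurry fun s y : ℝ => |s - y| ^ (-γ) * g y) := by
    unfold Function.uncurry
    fun_prop
  have hint := integrable_abs_sub_rpow_mul_of_le hq hqγ hγ1 hgm hgM
  rw [integrable_prod_iff hmeas.aestronglyMeasurable]
  refine ⟨ae_of_all _ hint, (integrable_const (M * rieszConst γ q)).mono'
    hmeas.norm.stronglyMeasurable.integral_prod_right.aestronglyMeasurable
    (ae_of_all _ fun s => ?_)⟩
  rw [Real.norm_of_nonneg (integral_nonneg fun y => norm_nonneg _)]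
  calc _ ≤ ∫ y, M * (|s - y| ^ (-γ) * (1 + |y|) ^ (q - 1)) :=
        integral_mono (hint s).norm ((integrable_abs_sub_rpow_mul hq hqγ hγ1 s).const_mul M)
          (norm_abs_sub_rpow_mul_le hgM s)
    _ ≤ _ := by
        rw [integral_const_mul]
        exact mul_le_mul_of_nonneg_left (integral_abs_sub_rpow_mul_le hq hqγ hγ1 s) hM

theorem integrableOn_mul_kernelAntideriv_and_integral_rieszPotential (hq : 0 ≤ q) (hqγ : q < γ)
    (hγ1 : γ < 1) (hgm : Measurable g) (hgM : ∀ y, |g y| ≤ M * (1 + |y|) ^ (q - 1))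
    (heven : Function.Even g) (hx : 0 ≤ x) :
    IntegrableOn (fun y => g y * kernelAntideriv γ x y) (Ioi 0) ∧
      ∫ s in (0 : ℝ)..x, rieszPotential γ g s = ∫ y in Ioi 0, g y * kernelAntideriv γ x y := by
  have hprod := integrable_prod_abs_sub_rpow_mul hq hqγ hγ1 hgm hgM x
  set G : ℝ → ℝ := fun y => (kernelPrimitive γ (x - y) - kernelPrimitive γ (0 - y)) * g y
    with hG
  have hinner : ∀ y, ∫ s in Ioc 0 x, |s - y| ^ (-γ) * g y = G y := by
    intro y
    rw [integral_mul_const, ← intervalIntegral.integral_of_le hx, integral_abs_sub_rpow_neg hγ1]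
  have hGint : Integrable G := hprod.integral_prod_right.congr (ae_of_all _ hinner)
  have hfold : ∀ y, G y + G (-y) = g y * kernelAntideriv γ x y := by
    intro y
    simp only [hG, kernelAntideriv, heven y, zero_sub, kernelPrimitive_neg, sub_neg_eq_add]
    ring
  constructor
  · simp only [← hfold]
    exact (hGint.add hGint.comp_neg).integrableOn
  · rw [intervalIntegral.integral_of_le hx]
    simp only [rieszPotential]
    rw [integral_integral_swap hprod]
    simp only [hinner]
    rw [integral_eq_integral_Ioi_add_neg hGint]
    simp only [hfold]

theorem integral_deriv_mul_kernelAntideriv_sub {R : ℝ} (hγ1 : γ < 1) (hf : ContDiff ℝ 1 f)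
    (hf0 : f 0 = 0) (hx : 0 ≤ x) (hR : 0 ≤ R)
    (hint : IntegrableOn (fun y => deriv f y * kernelAntideriv γ x y - kernel γ x y * f y)
      (Ioi 0)) :
    ∫ y in (0 : ℝ)..R, (deriv f y * kernelAntideriv γ x y - kernel γ x y * f y) =
      f R * kernelAntideriv γ x R := by
  have hcont : Continuous fun y => f y * kernelAntideriv γ x y :=
    hf.continuous.mul (continuous_kernelAntideriv hγ1 x)
  rw [integral_eq_of_hasDerivAt_off_countable_of_le (fun y => f y * kernelAntideriv γ x y) _
    hR (countable_singleton x) hcont.continuousOn, hf0, zero_mul, sub_zero]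
  · rintro y ⟨hy, hyx⟩
    have hderiv := (hf.differentiable one_ne_zero y).hasDerivAt.mul
      (hasDerivAt_kernelAntideriv hγ1 (Ne.symm hyx) (by linarith [hy.1] : 0 < x + y).ne')
    exact hderiv.congr_deriv (by ring)
  · rw [intervalIntegrable_iff_integrableOn_Ioc_of_le hR]
    exact hint.mono_set Ioc_subset_Ioi_self

theorem even_deriv_of_odd (hodd : Function.Odd f) : Function.Even (deriv f) := by
  intro x
  have h := deriv_comp_neg f x
  rw [funext hodd, deriv.fun_neg, neg_inj] at h
  exact h.symm

theorem velocity_eq_of_nonneg (hq : 0 ≤ q) (hqγ : q < γ) (hγ1 : γ < 1) (hf : ContDiff ℝ 1 f)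
    (hodd : Function.Odd f) (hfN : WeightedBound 1 q N f)
    (hfM : ∀ y, |deriv f y| ≤ M * (1 + |y|) ^ (q - 1)) (hx : 0 ≤ x) :
    velocity γ f x = -∫ s in (0 : ℝ)..x, rieszPotential γ (deriv f) s := by
  obtain ⟨hint, hriesz⟩ := integrableOn_mul_kernelAntideriv_and_integral_rieszPotential hq hqγ hγ1
    (measurable_deriv f) hfM (even_deriv_of_odd hodd) hx
  have hkint := integrableOn_kernel_mul hγ1 hq hqγ one_pos hfN hf.continuous.measurable hx
  have hzero :
      ∫ y in Ioi 0, (deriv f y * kernelAntideriv γ x y - kernel γ x y * f y) = 0 := by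
    refine tendsto_nhds_unique
      (intervalIntegral_tendsto_integral_Ioi 0 (hint.sub hkint) tendsto_id) ?_
    refine (tendsto_mul_kernelAntideriv hq hqγ hγ1 hfN hx).congr' ?_
    filter_upwards [eventually_ge_atTop 0] with R hR
    exact (integral_deriv_mul_kernelAntideriv_sub hγ1 hf hodd.map_zero hx hR
      (hint.sub hkint)).symm
  rw [integral_sub hint hkint, sub_eq_zero] at hzero
  rw [velocity, hriesz, hzero]

theorem velocity_neg (γ : ℝ) (f : ℝ → ℝ) (x : ℝ) : velocity γ f (-x) = -velocity γ f x := by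
  have hkernel : ∀ y, kernel γ (-x) y = -kernel γ x y := by
    intro y
    rw [kernel, kernel, sub_neg_eq_add, neg_add_eq_sub, add_comm y x, neg_sub]
  simp only [velocity, hkernel, neg_mul, integral_neg]

theorem rieszPotential_neg (heven : Function.Even g) (x : ℝ) :
    rieszPotential γ g (-x) = rieszPotential γ g x := by
  rw [rieszPotential, ← integral_neg_eq_self]
  simp only [heven _, neg_sub_neg, abs_sub_comm, rieszPotential]

theorem velocity_eq_neg_integral_rieszPotential (hq : 0 ≤ q) (hqγ : q < γ) (hγ1 : γ < 1)
    (hf : ContDiff ℝ 1 f) (hodd : Function.Odd f) (hfN : WeightedBound 1 q N f)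
    (hfM : ∀ y, |deriv f y| ≤ M * (1 + |y|) ^ (q - 1)) (x : ℝ) :
    velocity γ f x = -∫ s in (0 : ℝ)..x, rieszPotential γ (deriv f) s := by
  rcases le_total 0 x with hx | hx
  · exact velocity_eq_of_nonneg hq hqγ hγ1 hf hodd hfN hfM hx
  · have hpos := velocity_eq_of_nonneg hq hqγ hγ1 hf hodd hfN hfM (neg_nonneg.2 hx)
    have hreflect := intervalIntegral.integral_comp_neg (a := 0) (b := x)
      (rieszPotential γ (deriv f))
    simp only [rieszPotential_neg (even_deriv_of_odd hodd), neg_zero] at hreflect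
    rw [velocity_neg] at hpos
    rw [hreflect, intervalIntegral.integral_symm]
    linarith

end rieszPotential

/-! ### Regularity of flow maps and their inverses -/

section displacement

/-- The functional `v ↦ ∫ s in 0..x, v |s|`, the displacement of the particle `x` under the flow map
of `v`. -/
def displacement (x : ℝ) : (ℝ →ᵇ ℝ) →L[ℝ] ℝ :=
  LinearMap.mkContinuous
    { toFun := fun v => ∫ s in (0 : ℝ)..x, v |s|
      map_add' := fun v w => intervalIntegral.integral_add
        ((continuous_comp_abs v).intervalIntegrable _ _)
        ((continuous_comp_abs w).intervalIntegrable _ _)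
      map_smul' := fun c v => intervalIntegral.integral_const_mul c _ }
    |x| fun v => by simpa [mul_comm] using abs_integral_comp_abs_le v x 0

theorem displacement_apply (x : ℝ) (v : ℝ →ᵇ ℝ) :
    displacement x v = ∫ s in (0 : ℝ)..x, v |s| := rfl

theorem flowMap_eq_add_displacement (v : ℝ →ᵇ ℝ) (x : ℝ) :
    flowMap v x = x + displacement x v := rfl

theorem continuous_displacement : Continuous displacement := by
  suffices h : LipschitzWith 1 displacement from h.continuous
  refine LipschitzWith.of_dist_le_mul fun x y => ?_
  rw [dist_eq_norm, NNReal.coe_one, one_mul, Real.dist_eq]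
  refine ContinuousLinearMap.opNorm_le_bound _ (abs_nonneg _) fun v => ?_
  have hsub : (displacement x - displacement y) v = ∫ s in y..x, v |s| := by
    have h := flowMap_sub v x y
    rw [flowMap_eq_add_displacement, flowMap_eq_add_displacement] at h
    rw [sub_apply]
    linarith
  rw [hsub, mul_comm]
  exact abs_integral_comp_abs_le v x y

theorem continuous_displacement_coprod : Continuous fun u : (ℝ →ᵇ ℝ) × ℝ =>
    (displacement u.2).coprod (ContinuousLinearMap.toSpanSingleton ℝ (1 + u.1 |u.2|)) :=
  (continuous_displacement.comp continuous_snd).continuousLinearMapCoprod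
    ((ContinuousLinearMap.toSpanSingletonCLE (𝕜 := ℝ) (E := ℝ)).continuous.comp (by fun_prop))

theorem hasFDerivAt_flowMap (u : (ℝ →ᵇ ℝ) × ℝ) :
    HasFDerivAt (fun u : (ℝ →ᵇ ℝ) × ℝ => flowMap u.1 u.2)
      ((displacement u.2).coprod (ContinuousLinearMap.toSpanSingleton ℝ (1 + u.1 |u.2|))) u :=
  (hasStrictFDerivAt_uncurry_coprod (f := flowMap) (f₁ := fun _ x => displacement x)
    (f₂ := fun v x => ContinuousLinearMap.toSpanSingleton ℝ (1 + v |x|))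
    (Eventually.of_forall fun u => (displacement u.2).hasFDerivAt.const_add u.2)
    (Eventually.of_forall fun u => (hasDerivAt_flowMap u.1 u.2).hasFDerivAt)
    (continuous_displacement.comp continuous_snd).continuousAt
    ((ContinuousLinearMap.toSpanSingletonCLE (𝕜 := ℝ) (E := ℝ)).continuous.comp
      (by fun_prop)).continuousAt).hasFDerivAt

theorem contDiff_flowMap : ContDiff ℝ 1 fun u : (ℝ →ᵇ ℝ) × ℝ => flowMap u.1 u.2 :=
  contDiff_one_iff_hasFDerivAt.2 ⟨_, continuous_displacement_coprod, hasFDerivAt_flowMap⟩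

end displacement

section labelMap

variable {v : ℝ →ᵇ ℝ}

/-- The inverse of the flow map, sending a position to its Lagrangian label (for `‖v‖ ≤ 1 / 2`). -/
def labelMap (v : ℝ →ᵇ ℝ) : ℝ → ℝ := Function.invFun (flowMap v)

theorem labelMap_flowMap (hv : ‖v‖ ≤ 1 / 2) (x : ℝ) : labelMap v (flowMap v x) = x :=
  Function.leftInverse_invFun (flowMap_injective hv) x

theorem flowMap_labelMap (hv : ‖v‖ ≤ 1 / 2) (x : ℝ) : flowMap v (labelMap v x) = x :=
  Function.rightInverse_invFun (flowMap_surjective hv) x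

theorem labelMap_neg (hv : ‖v‖ ≤ 1 / 2) (x : ℝ) : labelMap v (-x) = -labelMap v x := by
  apply flowMap_injective hv
  rw [flowMap_neg, flowMap_labelMap hv, flowMap_labelMap hv]

theorem labelMap_zero_apply (x : ℝ) : labelMap 0 x = x := by
  simpa [flowMap] using flowMap_labelMap (v := 0) (by simp) x

theorem labelMap_nonneg (hv : ‖v‖ ≤ 1 / 2) {x : ℝ} (hx : 0 ≤ x) : 0 ≤ labelMap v x := by
  by_contra! hneg
  have h := half_le_flowMap hv (neg_nonneg.2 hneg.le)
  rw [flowMap_neg, flowMap_labelMap hv] at h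
  linarith

theorem labelMap_le_two_mul (hv : ‖v‖ ≤ 1 / 2) {x : ℝ} (hx : 0 ≤ x) : labelMap v x ≤ 2 * x := by
  have h := half_le_flowMap hv (labelMap_nonneg hv hx)
  rw [flowMap_labelMap hv] at h
  linarith

theorem abs_le_two_mul_abs_labelMap (hv : ‖v‖ ≤ 1 / 2) (x : ℝ) : |x| ≤ 2 * |labelMap v x| := by
  set a := labelMap v x with ha
  have hdisp : |displacement a v| ≤ 1 / 2 * |a| := by
    refine (abs_integral_comp_abs_le v a 0).trans ?_
    rw [sub_zero]
    gcongr
  calc |x| = |a + displacement a v| := by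
        rw [← flowMap_eq_add_displacement, ha, flowMap_labelMap hv]
    _ ≤ |a| + 1 / 2 * |a| := (abs_add_le _ _).trans (by gcongr)
    _ ≤ 2 * |a| := by linarith [abs_nonneg a]

theorem continuousOn_labelMap : ContinuousOn (fun u : (ℝ →ᵇ ℝ) × ℝ => labelMap u.1 u.2)
    (Metric.ball 0 (1 / 2) ×ˢ univ) := by
  have hball : ∀ u ∈ Metric.ball (0 : ℝ →ᵇ ℝ) (1 / 2) ×ˢ (univ : Set ℝ), ‖u.1‖ ≤ 1 / 2 :=
    fun u hu => (mem_ball_zero_iff.1 hu.1).le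
  intro u₀ hu₀
  set a := labelMap u₀.1 u₀.2 with ha
  have hcont : Continuous fun u : (ℝ →ᵇ ℝ) × ℝ => 2 * |u.2 - flowMap u.1 a| := by
    have hflow : Continuous fun u : (ℝ →ᵇ ℝ) × ℝ => flowMap u.1 a :=
      contDiff_flowMap.continuous.comp (by fun_prop : Continuous fun u : (ℝ →ᵇ ℝ) × ℝ => (u.1, a))
    fun_prop
  have hlim : Tendsto (fun u : (ℝ →ᵇ ℝ) × ℝ => 2 * |u.2 - flowMap u.1 a|)
      (𝓝[Metric.ball 0 (1 / 2) ×ˢ univ] u₀) (𝓝 0) := by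
    have h := hcont.tendsto u₀
    simp only [ha, flowMap_labelMap (hball u₀ hu₀), sub_self, abs_zero, mul_zero] at h
    exact h.mono_left nhdsWithin_le_nhds
  rw [ContinuousWithinAt, tendsto_iff_dist_tendsto_zero]
  refine squeeze_zero' (Eventually.of_forall fun _ => dist_nonneg) ?_ hlim
  filter_upwards [self_mem_nhdsWithin] with u hu
  have h := half_abs_sub_le_abs_flowMap_sub (hball u hu) (labelMap u.1 u.2) a
  rw [flowMap_labelMap (hball u hu)] at h
  rw [Real.dist_eq]
  linarith

/-- The map `(v, x) ↦ (v, flowMap v x)` with its inverse. -/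
def flowHomeomorph : OpenPartialHomeomorph ((ℝ →ᵇ ℝ) × ℝ) ((ℝ →ᵇ ℝ) × ℝ) where
  toFun u := (u.1, flowMap u.1 u.2)
  invFun u := (u.1, labelMap u.1 u.2)
  source := Metric.ball 0 (1 / 2) ×ˢ univ
  target := Metric.ball 0 (1 / 2) ×ˢ univ
  map_source' _ hu := ⟨hu.1, mem_univ _⟩
  map_target' _ hu := ⟨hu.1, mem_univ _⟩
  left_inv' u hu := Prod.ext rfl (labelMap_flowMap (mem_ball_zero_iff.1 hu.1).le u.2)
  right_inv' u hu := Prod.ext rfl (flowMap_labelMap (mem_ball_zero_iff.1 hu.1).le u.2)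
  continuousOn_toFun := (continuous_fst.prodMk contDiff_flowMap.continuous).continuousOn
  continuousOn_invFun := continuous_fst.continuousOn.prodMk continuousOn_labelMap
  open_source := Metric.isOpen_ball.prod isOpen_univ
  open_target := Metric.isOpen_ball.prod isOpen_univ

theorem one_add_pos (hv : ‖v‖ ≤ 1 / 2) (x : ℝ) : 0 < 1 + v x :=
  (by norm_num : (0 : ℝ) < 1 / 2).trans_le (half_le_one_add hv x)

/-- `flowHomeomorph` has derivative `(w, h) ↦ (w, (1 + v |a|) h + displacement a w)` at `(v, a)`,
a shear that is invertible because `1 + v |a|` is positive. -/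
theorem contDiffOn_labelMap : ContDiffOn ℝ 1 (fun u : (ℝ →ᵇ ℝ) × ℝ => labelMap u.1 u.2)
    (Metric.ball 0 (1 / 2) ×ˢ univ) := by
  intro u hu
  have hv : ‖u.1‖ ≤ 1 / 2 := (mem_ball_zero_iff.1 hu.1).le
  set a := labelMap u.1 u.2
  let c : ℝˣ := Units.mk0 (1 + u.1 |a|) (one_add_pos hv |a|).ne'
  let shear : ((ℝ →ᵇ ℝ) × ℝ) ≃L[ℝ] ((ℝ →ᵇ ℝ) × ℝ) :=
    (ContinuousLinearEquiv.refl ℝ (ℝ →ᵇ ℝ)).skewProd (ContinuousLinearEquiv.unitsEquivAut ℝ c)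
      (displacement a)
  have hderiv : HasFDerivAt flowHomeomorph (shear : _ →L[ℝ] _) (flowHomeomorph.symm u) := by
    refine (hasFDerivAt_fst.prodMk (hasFDerivAt_flowMap (u.1, a))).congr_fderiv ?_
    ext w <;> simp [shear, c]
  exact (flowHomeomorph.contDiffAt_symm (n := 1) hu hderiv
    (contDiff_fst.prodMk contDiff_flowMap).contDiffAt).snd.contDiffWithinAt

theorem contDiff_labelMap (hv : ‖v‖ < 1 / 2) : ContDiff ℝ 1 (labelMap v) := by
  rw [← contDiffOn_univ]
  exact contDiffOn_labelMap.comp (f := fun x : ℝ => (v, x)) (by fun_prop)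
    fun x _ => ⟨mem_ball_zero_iff.2 hv, mem_univ _⟩

theorem hasDerivAt_labelMap (hv : ‖v‖ < 1 / 2) (x : ℝ) :
    HasDerivAt (labelMap v) (1 + v |labelMap v x|)⁻¹ x :=
  HasDerivAt.of_local_left_inverse (contDiff_labelMap hv).continuous.continuousAt
    (hasDerivAt_flowMap v (labelMap v x)) (one_add_pos hv.le _).ne'
    (Eventually.of_forall (flowMap_labelMap hv.le))

end labelMap

/-! ### Existence -/

section transported

variable {γ q M N : ℝ} {ω₀ : ℝ → ℝ} {v : ℝ →ᵇ ℝ}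

theorem WeightedBound.comp_labelMap (hq : 0 ≤ q) (hq1 : q ≤ 1) (hN : WeightedBound 1 q N ω₀)
    (hv : ‖v‖ ≤ 1 / 2) : WeightedBound 1 q (2 * N) fun x => ω₀ (labelMap v x) := by
  intro x hx
  have hN0 := hN.nonneg one_pos
  have ha := labelMap_nonneg hv hx
  calc |ω₀ (labelMap v x)| ≤ N * (1 + labelMap v x) ^ q := hN ha
    _ ≤ N * (2 * (1 + x)) ^ q := by
        gcongr
        linarith [labelMap_le_two_mul hv hx]
    _ ≤ N * (2 * (1 + x) ^ q) := by
        gcongr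
        exact mul_rpow_le_mul_rpow one_le_two (by linarith) hq1
    _ = 2 * N * (1 + x) ^ q := by ring

theorem hasDerivAt_comp_labelMap (hω₀ : Differentiable ℝ ω₀) (hv : ‖v‖ < 1 / 2) (x : ℝ) :
    HasDerivAt (fun x => ω₀ (labelMap v x))
      (deriv ω₀ (labelMap v x) * (1 + v |labelMap v x|)⁻¹) x :=
  (hω₀ (labelMap v x)).hasDerivAt.comp x (hasDerivAt_labelMap hv x)

theorem abs_deriv_comp_labelMap_le (hω₀ : Differentiable ℝ ω₀) (hq : 0 ≤ q) (hq1 : q ≤ 1)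
    (hM : ∀ y, |deriv ω₀ y| ≤ M * (1 + |y|) ^ (q - 1)) (hv : ‖v‖ < 1 / 2) (x : ℝ) :
    |deriv (fun x => ω₀ (labelMap v x)) x| ≤ 4 * M * (1 + |x|) ^ (q - 1) := by
  set a := labelMap v x
  have hM0 := nonneg_of_forall_abs_le_mul_rpow hM
  have hjacobian : |(1 + v |a|)⁻¹| ≤ 2 := by
    rw [abs_of_pos (inv_pos.2 (one_add_pos hv.le _)), inv_le_comm₀ (one_add_pos hv.le _) two_pos,
      ← one_div]
    exact half_le_one_add hv.le _
  have hweight : (1 + |a|) ^ (q - 1) ≤ 2 * (1 + |x|) ^ (q - 1) := by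
    calc (1 + |a|) ^ (q - 1) ≤ (2⁻¹ * (1 + |x|)) ^ (q - 1) :=
          Real.rpow_le_rpow_of_nonpos (by positivity)
            (by linarith [abs_le_two_mul_abs_labelMap hv.le x, abs_nonneg a]) (by linarith)
      _ = 2 ^ (1 - q) * (1 + |x|) ^ (q - 1) := by
          rw [Real.mul_rpow (by positivity) (by positivity), Real.inv_rpow zero_le_two,
            ← Real.rpow_neg zero_le_two, neg_sub]
      _ ≤ 2 * (1 + |x|) ^ (q - 1) := by
          gcongr
          exact Real.rpow_le_self_of_one_le one_le_two (by linarith)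
  rw [(hasDerivAt_comp_labelMap hω₀ hv x).deriv, abs_mul]
  calc |deriv ω₀ a| * |(1 + v |a|)⁻¹| ≤ M * (1 + |a|) ^ (q - 1) * 2 := by
        gcongr
        exact hM a
    _ ≤ M * (2 * (1 + |x|) ^ (q - 1)) * 2 := by gcongr
    _ = 4 * M * (1 + |x|) ^ (q - 1) := by ring

theorem rieszPotential_deriv_comp_labelMap (hω₀ : Differentiable ℝ ω₀) (hv : ‖v‖ < 1 / 2) (a : ℝ) :
    rieszPotential γ (deriv fun x => ω₀ (labelMap v x)) (flowMap v a) =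
      -strain γ (deriv ω₀) v a := by
  rw [rieszPotential, strain, neg_neg, ← setIntegral_univ,
    ← (flowMap_surjective hv.le).range_eq, ← image_univ,
    integral_image_eq_integral_abs_deriv_smul MeasurableSet.univ
      (fun x _ => (hasDerivAt_flowMap v x).hasDerivWithinAt) (flowMap_injective hv.le).injOn,
    setIntegral_univ]
  refine integral_congr_ae (ae_of_all _ fun y => ?_)
  have hpos := one_add_pos hv.le |y|
  simp only [(hasDerivAt_comp_labelMap hω₀ hv _).deriv, labelMap_flowMap hv.le, smul_eq_mul,
    abs_of_pos hpos]
  field_simp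

/-- Differentiating in the label, both sides have derivative `(1 + v |a|) * strain γ ω₀' v a`. -/
theorem velocity_comp_labelMap_flowMap (hω₀ : ContDiff ℝ 1 ω₀) (hodd : Function.Odd ω₀)
    (hq : 0 ≤ q) (hqγ : q < γ) (hγ1 : γ < 1) (hN : WeightedBound 1 q N ω₀)
    (hM : ∀ y, |deriv ω₀ y| ≤ M * (1 + |y|) ^ (q - 1)) (hv : ‖v‖ < 1 / 2) (a : ℝ) :
    velocity γ (fun x => ω₀ (labelMap v x)) (flowMap v a) =
      displacement a (lagrangianField γ (deriv ω₀) v) := by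
  have hdiff := hω₀.differentiable one_ne_zero
  have hderiv : Continuous (deriv ω₀) := hω₀.continuous_deriv le_rfl
  have hq1 : q ≤ 1 := (hqγ.trans hγ1).le
  have hpotential : ∀ s, rieszPotential γ (deriv fun x => ω₀ (labelMap v x)) s =
      -strain γ (deriv ω₀) v (labelMap v s) := fun s => by
    rw [← rieszPotential_deriv_comp_labelMap hdiff hv, flowMap_labelMap hv.le]
  have hcont : Continuous fun s => strain γ (deriv ω₀) v (labelMap v s) :=
    (continuous_strain hq hqγ hγ1 hderiv hM hv.le).comp (contDiff_labelMap hv).continuous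
  rw [velocity_eq_neg_integral_rieszPotential (f := fun x => ω₀ (labelMap v x)) hq hqγ hγ1
    (hω₀.comp (contDiff_labelMap hv)) (fun x => by simp only [labelMap_neg hv.le, hodd _])
    (hN.comp_labelMap hq hq1 hv.le) (abs_deriv_comp_labelMap_le hdiff hq hq1 hM hv)]
  calc -∫ s in (0 : ℝ)..flowMap v a, rieszPotential γ (deriv fun x => ω₀ (labelMap v x)) s
      = ∫ s in flowMap v 0..flowMap v a, strain γ (deriv ω₀) v (labelMap v s) := by
        simp only [hpotential, intervalIntegral.integral_neg, neg_neg, flowMap_apply_zero]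
    _ = ∫ s in (0 : ℝ)..a, strain γ (deriv ω₀) v (labelMap v (flowMap v s)) * (1 + v |s|) :=
        (intervalIntegral.integral_comp_mul_deriv (fun x _ => hasDerivAt_flowMap v x)
          (by fun_prop) hcont).symm
    _ = displacement a (lagrangianField γ (deriv ω₀) v) := by
        rw [displacement_apply]
        refine intervalIntegral.integral_congr fun s _ => ?_
        simp only [labelMap_flowMap hv.le, lagrangianField_apply hq hqγ hγ1 hderiv hM hv.le,
          strain_abs (even_deriv_of_odd hodd), mul_comm]

end transported

theorem deriv_add_mul_deriv_eq_zero_of_const_along {ω : ℝ → ℝ → ℝ} {X : ℝ → ℝ} {t b c : ℝ}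
    (hω : DifferentiableAt ℝ (fun z : ℝ × ℝ => ω z.1 z.2) (t, X t)) (hX : HasDerivAt X b t)
    (hconst : ∀ᶠ s in 𝓝 t, ω s (X s) = c) :
    deriv (fun s => ω s (X t)) t + b * deriv (ω t) (X t) = 0 := by
  set D := fderiv ℝ (fun z : ℝ × ℝ => ω z.1 z.2) (t, X t)
  have hD : HasFDerivAt (fun z : ℝ × ℝ => ω z.1 z.2) D (t, X t) := hω.hasFDerivAt
  have htime : HasDerivAt (fun s => ω s (X t)) (D (1, 0)) t :=
    hD.comp_hasDerivAt (f := fun s => (s, X t)) t ((hasDerivAt_id t).prodMk (hasDerivAt_const t _))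
  have hspace : HasDerivAt (ω t) (D (0, 1)) (X t) :=
    hD.comp_hasDerivAt (f := fun y => (t, y)) _ ((hasDerivAt_const _ t).prodMk (hasDerivAt_id _))
  have htotal : HasDerivAt (fun s => ω s (X s)) (D (1, b)) t :=
    hD.comp_hasDerivAt (f := fun s => (s, X s)) t ((hasDerivAt_id t).prodMk hX)
  have hzero : D (1, b) = 0 :=
    htotal.unique ((hasDerivAt_const t c).congr_of_eventuallyEq hconst)
  have hsplit : D (1, b) = D (1, 0) + b * D (0, 1) := by
    rw [← smul_eq_mul, ← map_smul, ← map_add]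
    simp
  rw [htime.deriv, hspace.deriv, ← hsplit, hzero]

section lagrangianCurve

variable {γ q M N t : ℝ} {ω₀ : ℝ → ℝ} {v : ℝ → ℝ →ᵇ ℝ} {I : Set ℝ}

theorem contDiffOn_comp_labelMap (hω₀ : ContDiff ℝ 1 ω₀) (hv : ∀ t ∈ I, ‖v t‖ < 1 / 2)
    (hvC : ContDiffOn ℝ 1 v I) :
    ContDiffOn ℝ 1 (fun z : ℝ × ℝ => ω₀ (labelMap (v z.1) z.2)) (I ×ˢ univ) :=
  hω₀.comp_contDiffOn (contDiffOn_labelMap.comp (f := fun z : ℝ × ℝ => (v z.1, z.2))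
    ((hvC.comp contDiff_fst.contDiffOn fun _ hz => hz.1).prodMk contDiff_snd.contDiffOn)
    fun z hz => ⟨mem_ball_zero_iff.2 (hv z.1 hz.1), mem_univ _⟩)

theorem deriv_add_velocity_mul_deriv_comp_labelMap (hω₀ : ContDiff ℝ 1 ω₀)
    (hodd : Function.Odd ω₀) (hq : 0 ≤ q) (hqγ : q < γ) (hγ1 : γ < 1)
    (hN : WeightedBound 1 q N ω₀) (hM : ∀ y, |deriv ω₀ y| ≤ M * (1 + |y|) ^ (q - 1))
    (hI : IsOpen I) (hv : ∀ t ∈ I, ‖v t‖ < 1 / 2) (hvC : ContDiffOn ℝ 1 v I)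
    (hvd : ∀ t ∈ I, HasDerivAt v (lagrangianField γ (deriv ω₀) (v t)) t) (ht : t ∈ I) (x : ℝ) :
    deriv (fun s => ω₀ (labelMap (v s) x)) t + velocity γ (fun y => ω₀ (labelMap (v t) y)) x *
      deriv (fun y => ω₀ (labelMap (v t) y)) x = 0 := by
  obtain ⟨a, rfl⟩ := flowMap_surjective (hv t ht).le x
  rw [velocity_comp_labelMap_flowMap hω₀ hodd hq hqγ hγ1 hN hM (hv t ht)]
  refine deriv_add_mul_deriv_eq_zero_of_const_along (ω := fun s x => ω₀ (labelMap (v s) x))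
    (X := fun s => flowMap (v s) a) (c := ω₀ a) ?_ ?_ ?_
  · exact ((contDiffOn_comp_labelMap hω₀ hv hvC).contDiffAt
      ((hI.prod isOpen_univ).mem_nhds ⟨ht, mem_univ _⟩)).differentiableAt one_ne_zero
  · exact ((displacement a).hasFDerivAt.comp_hasDerivAt t (hvd t ht)).const_add a
  · filter_upwards [hI.mem_nhds ht] with s hs
    rw [labelMap_flowMap (hv s hs).le]

end lagrangianCurve

theorem WeightedBound.abs_le {L s N : ℝ} {f : ℝ → ℝ} (hf : WeightedBound L s N f)
    (heven : Function.Even f) (y : ℝ) : |f y| ≤ N * (L + |y|) ^ s := by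
  have h := hf (abs_nonneg y)
  rcases abs_choice y with hy | hy
  · rwa [congrArg f hy] at h
  · rwa [congrArg f hy, heven] at h

theorem exists_isSolution {γ q M N : ℝ} {ω₀ : ℝ → ℝ} (hω₀ : ContDiff ℝ 1 ω₀)
    (hodd : Function.Odd ω₀) (hq : 0 ≤ q) (hqγ : q < γ) (hγ1 : γ < 1)
    (hN : WeightedBound 1 q N ω₀) (hM : WeightedBound 1 (q - 1) M (deriv ω₀)) :
    ∃ T : ℝ, 0 < T ∧ ∃ ω : ℝ → ℝ → ℝ, IsSolution γ q T ω₀ ω ∧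
      ∀ t ∈ Icc 0 T, WeightedBound 1 (q - 1) (4 * M) (deriv (ω t)) := by
  have hM' := hM.abs_le (even_deriv_of_odd hodd)
  have hq1 : q ≤ 1 := (hqγ.trans hγ1).le
  obtain ⟨T, hT, v, hv0, hv, hvC, hvd⟩ :=
    exists_lagrangian_solution hq hqγ hγ1 (hω₀.continuous_deriv le_rfl) hM'
  have hsub : Icc 0 (T / 2) ⊆ Ioo (-T) T := fun t ht =>
    ⟨by linarith [ht.1], by linarith [ht.2]⟩
  have hderiv : ∀ t ∈ Icc 0 (T / 2),
      WeightedBound 1 (q - 1) (4 * M) (deriv fun x => ω₀ (labelMap (v t) x)) := by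
    intro t ht x hx
    have h := abs_deriv_comp_labelMap_le (hω₀.differentiable one_ne_zero) hq hq1 hM'
      (hv t (hsub ht)) x
    rwa [abs_of_nonneg hx] at h
  have hC := contDiffOn_comp_labelMap hω₀ hv hvC
  refine ⟨T / 2, half_pos hT, fun t x => ω₀ (labelMap (v t) x), ?_, hderiv⟩
  exact
    { contDiffOn := hC.mono (prod_mono_left hsub)
      odd := fun t ht x => by simp only [labelMap_neg (hv t (hsub ht)).le, hodd _]
      growth := fun t ht => ENNReal.add_lt_top.2
        ⟨weightedNorm_lt_top_iff.2 ⟨_, hN.comp_labelMap hq hq1 (hv t (hsub ht)).le⟩,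
          weightedNorm_lt_top_iff.2 ⟨_, hderiv t ht⟩⟩
      initial := fun x => by simp only [hv0, labelMap_zero_apply]
      equation := fun t ht x => by
        have htime : DifferentiableAt ℝ (fun s => ω₀ (labelMap (v s) x)) t :=
          ((hC.contDiffAt ((isOpen_Ioo.prod isOpen_univ).mem_nhds
            ⟨hsub ht, mem_univ x⟩)).differentiableAt one_ne_zero).comp
              (f := fun s : ℝ => (s, x)) t (by fun_prop)
        rw [htime.derivWithin (uniqueDiffOn_Icc (half_pos hT) t ht)]
        exact deriv_add_velocity_mul_deriv_comp_labelMap hω₀ hodd hq hqγ hγ1 hN hM' isOpen_Ioo hv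
          hvC hvd (hsub ht) x }

end AlphaPatch

end

theorem theorem1_general {γ q : ℝ} (hq : 0 < q) (hqγ : q < γ) (hγ1 : γ < 1) {ω₀ : ℝ → ℝ}
    (hω₀ : ContDiff ℝ 1 ω₀) (hodd : Function.Odd ω₀)
    (hnorm : AlphaPatch.weightedNorm q ω₀ + AlphaPatch.weightedNorm (q - 1) (deriv ω₀) < ⊤) :
    ∃ T : ℝ, 0 < T ∧
      (∃ ω : ℝ → ℝ → ℝ, AlphaPatch.IsSolution γ q T ω₀ ω) ∧
      ∀ ω₁ ω₂ : ℝ → ℝ → ℝ, AlphaPatch.IsSolution γ q T ω₀ ω₁ →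
        AlphaPatch.IsSolution γ q T ω₀ ω₂ →
        ∀ t ∈ Set.Icc 0 T, ∀ x, ω₁ t x = ω₂ t x := by
  obtain ⟨N, hN⟩ := AlphaPatch.weightedNorm_lt_top_iff.1 (ENNReal.add_lt_top.1 hnorm).1
  obtain ⟨M, hM⟩ := AlphaPatch.weightedNorm_lt_top_iff.1 (ENNReal.add_lt_top.1 hnorm).2
  obtain ⟨T, hT, ω, hω, hderiv⟩ :=
    AlphaPatch.exists_isSolution hω₀ hodd hq.le hqγ hγ1 hN hM
  have heq : ∀ ω' : ℝ → ℝ → ℝ, AlphaPatch.IsSolution γ q T ω₀ ω' →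
      ∀ t ∈ Set.Icc 0 T, ∀ x, ω' t x = ω t x := fun ω' h t ht =>
    hω.eq_of_deriv_weightedBound h hq hqγ hγ1 hderiv ht
  exact ⟨T, hT, ⟨ω, hω⟩, fun ω₁ ω₂ h₁ h₂ t ht x => (heq ω₁ h₁ t ht x).trans (heq ω₂ h₂ t ht x).symm⟩

theorem theorem1 (α γ q : ℝ) (hα : α ∈ Set.Ioo (0 : ℝ) 1) (hγ : γ = 1 - α)
    (hq : 0 < q) (hqγ : q < γ) (ω₀ : ℝ → ℝ) (hω₀ : ContDiff ℝ 2 ω₀)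
    (hodd : ∀ x, ω₀ (-x) = -ω₀ x)
    (hnorm : AlphaPatch.weightedNorm q ω₀ + AlphaPatch.weightedNorm (q - 1) (deriv ω₀)
      + AlphaPatch.weightedNorm (q - 2) (deriv (deriv ω₀)) < ⊤) :
    ∃ T : ℝ, 0 < T ∧
      (∃ ω : ℝ → ℝ → ℝ, AlphaPatch.IsSolution γ q T ω₀ ω) ∧
      ∀ ω₁ ω₂ : ℝ → ℝ → ℝ, AlphaPatch.IsSolution γ q T ω₀ ω₁ →
        AlphaPatch.IsSolution γ q T ω₀ ω₂ →
        ∀ t ∈ Set.Icc 0 T, ∀ x, ω₁ t x = ω₂ t x := by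
  exact theorem1_general hq hqγ (by linarith [hα.1]) (hω₀.of_le one_le_two) hodd
    (ENNReal.add_lt_top.1 hnorm).1
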